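/- **Setting.** A differential space is a topological space $X$ together with a set $C^\infty(X)$ of real functions such that $X$ carries the initial topology for $C^\infty(X)$, $C^\infty(X)$ is local (a continuous function that agrees near every point with an element of $C^\infty(X)$ belongs to $C^\infty(X)$), and $C^\infty(X)$ is closed under composition with smooth functions of finitely many variables; a map is smooth if it pulls smooth functions back to smooth functions. Let $C_*(X;\mathbb Z)$ be the complex of smooth singular chains, $Z_*(X;\mathbb Z)$ its cycles and $H^*(X;\mathbb Z)$ its integral cohomology. A $k$-form $\omega\in\Omega^k(X)$ assigns to each smooth $\sigma:\Delta^n\to X$ (all $n$) a smooth $k$-form $\sigma^*\omega$ on $\Delta^n$, compatibly with all smooth maps $\Delta^m\to\Delta^n$; moreover $\Omega^0(X)=C^\infty(X)$. Exterior derivative, pull-back and integration over smooth chains are defined simplexwise. Let $A$ and $X$ be differential spaces for which the de Rham theorem holds, i.e. integration induces isomorphisms from de Rham cohomology to smooth singular cohomology with real coefficients, and let $\varphi:A\to X$ be a smooth map. For $k\ge 1$ let $\widehat H^k(X;\mathbb Z)$ be the group of homomorphisms $h:Z_{k-1}(X;\mathbb Z)\to U(1)$ for which there is $\omega\in\Omega^k(X)$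 (the curvature) with $h(\partial c)=\exp(2\pi i\int_c\omega)$ for all $c\in C_k(X;\mathbb Z)$; $\widehat H^k_{\mathrm{flat}}(X;\mathbb Z)$ is the subgroup with $\omega=0$. The characteristic class $c(h)\in H^k(X;\mathbb Z)$ is the class of the cocycle $x\mapsto\int_x\omega-\tilde h(\partial x)$, with $\tilde h:Z_{k-1}(X;\mathbb Z)\to\mathbb R$ any real lift of $h$. Put $\widehat H^0(X;\mathbb Z):=H^0(X;\mathbb Z)$ with $c=\mathrm{id}$, and $\varphi^*h:=h\circ\varphi_*$. Let $C^\varphi_k(X,A;\mathbb Z)=C_k(X;\mathbb Z)\times C_{k-1}(A;\mathbb Z)$ be the mapping cone complex with $\partial_\varphi(s,t)=(\partial s+\varphi_*t,-\partial t)$ and cycles $Z^\varphi_k$. For $k\ge1$ let $\widehat H^k_\varphi(X,A;\mathbb Z)$ be the group of homomorphisms $f:Z^\varphi_{k-1}\to U(1)$ for which there are $\omega\in\Omega^k(X)$, $\vartheta\in\Omega^{k-1}(A)$ with $f(\partial_\varphi(x,y))=\exp\big(2\pi i(\int_x\omega+\int_y\vartheta)\big)$ for all $(x,y)\in C^\varphi_k(X,A;\mathbb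 Z)$; put $\widehat H^0_\varphi(X,A;\mathbb Z):=H^0_\varphi(X,A;\mathbb Z)$, the cohomology of the mapping cone complex. Let $i(g)(s,t)=g(t)$ for $g\in\widehat H^{k-1}(A;\mathbb Z)$, $k\ge2$, and $p(f)(z)=f(z,0)$; for $k=0$, $p$ is the natural map $H^0_\varphi(X,A;\mathbb Z)\to H^0(X;\mathbb Z)$. **Theorem (Exact sequence).** For $k\ge 2$ the sequence $$0\to\varphi^*\widehat H^{k-1}_{\mathrm{flat}}(X;\mathbb Z)\to\widehat H^{k-1}(A;\mathbb Z)\xrightarrow{\ i\ }\widehat H^k_\varphi(X,A;\mathbb Z)\xrightarrow{\ p\ }\widehat H^k(X;\mathbb Z)\xrightarrow{\varphi^*\circ c}\varphi^*H^k(X;\mathbb Z)\to 0$$ is exact, where the first map is the inclusion of a subgroup and $\varphi^*H^k(X;\mathbb Z)\subset H^k(A;\mathbb Z)$ is the image of $\varphi^*$. For $k=0$ and $k=1$ the sequence $$0\to\widehat H^k_\varphi(X,A;\mathbb Z)\xrightarrow{\ p\ }\widehat H^k(X;\mathbb Z)\xrightarrow{\varphi^*\circ c}\varphi^*H^k(X;\mathbb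 Z)\to 0$$ is exact. -/

import Mathlib

open scoped ContDiff Topology

namespace DiffCoh

universe u v w

/-! ### Differential spaces -/

/-- A differential space in the sense of Sikorski: a topological space `X` with a set
`smoothFun = C^∞(X)` of real functions such that `X` carries the initial topology, smoothness is
local, and smooth functions may be composed with smooth functions of several variables.
(That smooth functions are continuous follows from `initial`.) -/
class DifferentialSpace (X : Type u) extends TopologicalSpace X where
  smoothFun : Set (X → ℝ)
  initial : toTopologicalSpace =
    ⨅ f ∈ smoothFun, TopologicalSpace.induced f inferInstance
  locality : ∀ f : X → ℝ, Continuous f →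
    (∀ x, ∃ g ∈ smoothFun, f =ᶠ[𝓝 x] g) → f ∈ smoothFun
  composition : ∀ (n : ℕ) (f : Fin n → X → ℝ), (∀ i, f i ∈ smoothFun) →
    ∀ U : Set (Fin n → ℝ), _root_.IsOpen U → Set.univ.pi (fun i => Set.range (f i)) ⊆ U →
    ∀ g : (Fin n → ℝ) → ℝ, ContDiffOn ℝ ∞ g U → (fun x => g (fun i => f i x)) ∈ smoothFun

/-- `C^∞(X)`. -/
abbrev smoothFunctions (X : Type u) [DifferentialSpace X] : Set (X → ℝ) :=
  DifferentialSpace.smoothFun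

theorem smooth_zero (X : Type u) [DifferentialSpace X] :
    (fun _ => 0 : X → ℝ) ∈ smoothFunctions X :=
  DifferentialSpace.composition 0 (fun i => i.elim0) (fun i => i.elim0) Set.univ isOpen_univ
    (Set.subset_univ _) (fun _ => 0) contDiffOn_const

theorem smooth_add {X : Type u} [DifferentialSpace X] {f g : X → ℝ}
    (hf : f ∈ smoothFunctions X) (hg : g ∈ smoothFunctions X) :
    (fun x => f x + g x) ∈ smoothFunctions X := by
  have := DifferentialSpace.composition 2 ![f, g]
    (fun i => by fin_cases i <;> assumption) Set.univ isOpen_univ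
    (Set.subset_univ _) (fun v => v 0 + v 1) (ContDiff.contDiffOn (by fun_prop))
  simpa using this

theorem smooth_smul {X : Type u} [DifferentialSpace X] (a : ℝ) {f : X → ℝ}
    (hf : f ∈ smoothFunctions X) : (fun x => a * f x) ∈ smoothFunctions X := by
  have := DifferentialSpace.composition 1 ![f]
    (fun i => by fin_cases i; assumption) Set.univ isOpen_univ
    (Set.subset_univ _) (fun v => a * v 0) (ContDiff.contDiffOn (by fun_prop))
  simpa using this

/-- Smooth maps between differential spaces: smooth functions pull back to smooth functions. -/
structure SmoothMap (A : Type u) (X : Type v) [DifferentialSpace A] [DifferentialSpace X] where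
  toFun : A → X
  smooth : ∀ f ∈ smoothFunctions X, f ∘ toFun ∈ smoothFunctions A

/-! ### Standard simplices -/

/-- The standard `n`-simplex `{x ∈ ℝⁿ | xᵢ ≥ 0, ∑ xᵢ ≤ 1}`; its vertices are the origin
(vertex `0`) and the unit vectors (vertices `1, …, n`). -/
def stdSimplexIn (n : ℕ) : Set (Fin n → ℝ) := {x | (∀ i, 0 ≤ x i) ∧ ∑ i, x i ≤ 1}

/-- Barycentric coordinates. -/
def bary {n : ℕ} (x : Fin n → ℝ) : Fin (n + 1) → ℝ := Fin.cons (1 - ∑ i, x i) x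

theorem sum_bary {n : ℕ} (x : Fin n → ℝ) : ∑ j, bary x j = 1 := by
  simp [bary, Fin.sum_univ_succ]

theorem mem_stdSimplexIn_iff {n : ℕ} (x : Fin n → ℝ) :
    x ∈ stdSimplexIn n ↔ ∀ j, 0 ≤ bary x j := by
  simp only [stdSimplexIn, Set.mem_ofPred_eq, Fin.forall_fin_succ, bary, Fin.cons_zero,
    Fin.cons_succ, sub_nonneg]
  exact and_comm

theorem zero_mem_stdSimplexIn (n : ℕ) : (0 : Fin n → ℝ) ∈ stdSimplexIn n := by
  simp [stdSimplexIn]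

theorem convex_stdSimplexIn (n : ℕ) : Convex ℝ (stdSimplexIn n) := by
  intro x hx y hy a b ha hb hab
  refine ⟨fun i => ?_, ?_⟩
  · have := hx.1 i; have := hy.1 i
    simp only [Pi.add_apply, Pi.smul_apply, smul_eq_mul]; positivity
  · simp only [Pi.add_apply, Pi.smul_apply, smul_eq_mul, Finset.sum_add_distrib,
      ← Finset.mul_sum]
    nlinarith [hx.2, hy.2, mul_le_mul_of_nonneg_left hx.2 ha, mul_le_mul_of_nonneg_left hy.2 hb]

theorem isCompact_stdSimplexIn (n : ℕ) : IsCompact (stdSimplexIn n) := by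
  have hsub : stdSimplexIn n ⊆ Set.univ.pi (fun _ => Set.Icc (0 : ℝ) 1) := by
    intro x hx i _
    exact ⟨hx.1 i, (Finset.single_le_sum (fun j _ => hx.1 j) (Finset.mem_univ i)).trans hx.2⟩
  refine (isCompact_univ_pi fun _ => isCompact_Icc).of_isClosed_subset ?_ hsub
  have h1 : IsClosed {x : Fin n → ℝ | ∀ i, 0 ≤ x i} := by
    simp only [Set.ofPred_forall]
    exact isClosed_iInter fun i => isClosed_le continuous_const (continuous_apply i)
  have h2 : IsClosed {x : Fin n → ℝ | ∑ i, x i ≤ 1} :=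
    isClosed_le (by fun_prop) continuous_const
  exact h1.inter h2

theorem uniqueDiffOn_stdSimplexIn (n : ℕ) : UniqueDiffOn ℝ (stdSimplexIn n) := by
  refine uniqueDiffOn_convex (convex_stdSimplexIn n) ⟨fun _ => 1 / (n + 1 : ℝ), ?_⟩
  rw [mem_interior]
  refine ⟨{x | ∀ i, 0 < x i} ∩ {x | ∑ i, x i < 1}, fun x hx => ⟨fun i => (hx.1 i).le, hx.2.le⟩,
    ?_, ?_, ?_⟩
  · have h1 : IsOpen {x : Fin n → ℝ | ∀ i, 0 < x i} := by
      simp only [Set.ofPred_forall]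
      exact isOpen_iInter_of_finite fun i => isOpen_lt continuous_const (continuous_apply i)
    exact h1.inter (isOpen_lt (by fun_prop) continuous_const)
  · intro i; positivity
  · simp only [Set.mem_ofPred_eq, Finset.sum_const, Finset.card_univ, Fintype.card_fin,
      nsmul_eq_mul, mul_one_div]
    rw [div_lt_one (by positivity)]; linarith

/-- Smooth maps between standard simplices (restrictions of smooth maps of Euclidean spaces). -/
structure SimplexMap (m n : ℕ) where
  toFun : (Fin m → ℝ) → (Fin n → ℝ)
  smooth : ContDiff ℝ ∞ toFun
  mapsTo : Set.MapsTo toFun (stdSimplexIn m) (stdSimplexIn n)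

/-- The affine map of standard simplices which sends the vertex `j` to the vertex `θ j`. -/
def vertexMapFun {m n : ℕ} (θ : Fin (m + 1) → Fin (n + 1)) (x : Fin m → ℝ) : Fin n → ℝ :=
  fun l => ∑ j, if θ j = l.succ then bary x j else 0

theorem bary_vertexMapFun {m n : ℕ} (θ : Fin (m + 1) → Fin (n + 1)) (x : Fin m → ℝ)
    (l : Fin (n + 1)) : bary (vertexMapFun θ x) l = ∑ j, if θ j = l then bary x j else 0 := by
  refine Fin.cases ?_ (fun l => ?_) l
  · have h : ∑ l : Fin (n + 1), ∑ j, (if θ j = l then bary x j else 0) = 1 := by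
      rw [Finset.sum_comm]
      simp [sum_bary]
    rw [Fin.sum_univ_succ] at h
    simp only [bary, Fin.cons_zero, vertexMapFun] at h ⊢
    linarith
  · simp [bary, vertexMapFun]

theorem vertexMapFun_comp {m n p : ℕ} (θ : Fin (m + 1) → Fin (n + 1))
    (θ' : Fin (n + 1) → Fin (p + 1)) (x : Fin m → ℝ) :
    vertexMapFun θ' (vertexMapFun θ x) = vertexMapFun (θ' ∘ θ) x := by
  funext l
  rw [vertexMapFun, vertexMapFun]
  simp only [bary_vertexMapFun]
  have h : ∀ j, (if θ' j = l.succ then ∑ i, (if θ i = j then bary x i else 0) else 0)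
      = ∑ i, if θ i = j then (if θ' j = l.succ then bary x i else 0) else 0 := by
    intro j
    split_ifs <;> simp
  rw [Finset.sum_congr rfl fun j _ => h j, Finset.sum_comm]
  simp

def vertexMap {m n : ℕ} (θ : Fin (m + 1) → Fin (n + 1)) : SimplexMap m n where
  toFun := vertexMapFun θ
  smooth := by
    refine contDiff_pi.2 fun l => ContDiff.sum fun j _ => ?_
    split_ifs
    · refine Fin.cases ?_ (fun i => ?_) j
      · simp only [bary, Fin.cons_zero]; fun_prop
      · simp only [bary, Fin.cons_succ]; fun_prop
    · exact contDiff_const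
  mapsTo := by
    intro x hx
    rw [mem_stdSimplexIn_iff] at hx ⊢
    intro l
    rw [bary_vertexMapFun]
    exact Finset.sum_nonneg fun j _ => by split_ifs <;> simp [hx]

/-! ### Smooth singular simplices -/

/-- A smooth singular `n`-simplex in `X`: a smooth map from the standard `n`-simplex, with its
differential structure as a subspace of `ℝⁿ`, to `X`. -/
@[ext]
structure SSimplex (X : Type u) [DifferentialSpace X] (n : ℕ) where
  toFun : stdSimplexIn n → X
  smooth : ∀ f ∈ smoothFunctions X, ∃ F : (Fin n → ℝ) → ℝ,
    ContDiff ℝ ∞ F ∧ ∀ x : stdSimplexIn n, F x = f (toFun x)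

variable {X : Type u} [DifferentialSpace X] {A : Type v} [DifferentialSpace A]

/-- Reparametrization of a smooth simplex. -/
def SSimplex.comp {m n : ℕ} (σ : SSimplex X n) (g : SimplexMap m n) : SSimplex X m where
  toFun x := σ.toFun ⟨g.toFun x, g.mapsTo x.2⟩
  smooth f hf := by
    obtain ⟨F, hF, h⟩ := σ.smooth f hf
    exact ⟨F ∘ g.toFun, hF.comp g.smooth, fun x => h ⟨g.toFun x, g.mapsTo x.2⟩⟩

/-- Composition of a smooth simplex with a smooth map. -/
def SSimplex.push {n : ℕ} (φ : SmoothMap A X) (σ : SSimplex A n) : SSimplex X n where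
  toFun x := φ.toFun (σ.toFun x)
  smooth f hf := σ.smooth (f ∘ φ.toFun) (φ.smooth f hf)

/-- The `i`-th face of a smooth simplex, opposite to the vertex `i`. -/
def SSimplex.face {n : ℕ} (σ : SSimplex X (n + 1)) (i : Fin (n + 2)) : SSimplex X n :=
  σ.comp (vertexMap i.succAbove)

/-! ### Differential forms -/

/-- The space `Ω^k(X)` of smooth `k`-forms on a differential space `X`.
A `k`-form `α` assigns to every smooth map `σ : Δⁿ → X`, for all `n`, its pull-back `σ^*α`, a
smooth `k`-form on `Δⁿ` (set to `0` off `Δⁿ`), compatibly with all smooth maps `Δᵐ → Δⁿ`;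
a `0`-form is given by a smooth function on `X`. -/
noncomputable def Form (X : Type u) [DifferentialSpace X] (k : ℕ) :
    Submodule ℝ (∀ n : ℕ, SSimplex X n → (Fin n → ℝ) → (Fin n → ℝ) [⋀^Fin k]→L[ℝ] ℝ) where
  carrier := {α |
    (∀ (n : ℕ) (σ : SSimplex X n), ∃ η : (Fin n → ℝ) → (Fin n → ℝ) [⋀^Fin k]→L[ℝ] ℝ,
      ContDiff ℝ ∞ η ∧ ∀ x ∈ stdSimplexIn n, α n σ x = η x) ∧
    (∀ (n : ℕ) (σ : SSimplex X n), ∀ x ∉ stdSimplexIn n, α n σ x = 0) ∧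
    (∀ (m n : ℕ) (σ : SSimplex X n) (g : SimplexMap m n), ∀ x ∈ stdSimplexIn m,
      α m (σ.comp g) x =
        (α n σ (g.toFun x)).compContinuousLinearMap (fderiv ℝ g.toFun x)) ∧
    (k = 0 → ∃ f ∈ smoothFunctions X, ∀ (n : ℕ) (σ : SSimplex X n) (x : stdSimplexIn n)
      (v : Fin k → Fin n → ℝ), α n σ x v = f (σ.toFun x))}
  zero_mem' := by
    refine ⟨fun n σ => ⟨fun _ => 0, contDiff_const, fun _ _ => rfl⟩, fun _ _ _ _ => rfl, ?_,
      fun _ => ⟨_, smooth_zero X, fun _ _ _ _ => rfl⟩⟩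
    intro m n σ g x _
    ext v
    simp
  add_mem' := by
    rintro α α' ⟨h1, h2, h3, h4⟩ ⟨h1', h2', h3', h4'⟩
    refine ⟨fun n σ => ?_, fun n σ x hx => ?_, fun m n σ g x hx => ?_, fun hk => ?_⟩
    · obtain ⟨η, hη, h⟩ := h1 n σ
      obtain ⟨η', hη', h'⟩ := h1' n σ
      exact ⟨η + η', hη.add hη', fun x hx => by simp [h x hx, h' x hx]⟩
    · simp [h2 n σ x hx, h2' n σ x hx]
    · ext v
      simp [h3 m n σ g x hx, h3' m n σ g x hx]
    · obtain ⟨f, hf, h⟩ := h4 hk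
      obtain ⟨f', hf', h'⟩ := h4' hk
      exact ⟨_, smooth_add hf hf', fun n σ x v => by simp [h, h']⟩
  smul_mem' := by
    rintro a α ⟨h1, h2, h3, h4⟩
    refine ⟨fun n σ => ?_, fun n σ x hx => ?_, fun m n σ g x hx => ?_, fun hk => ?_⟩
    · obtain ⟨η, hη, h⟩ := h1 n σ
      exact ⟨a • η, hη.const_smul a, fun x hx => by simp [h x hx]⟩
    · simp [h2 n σ x hx]
    · ext v
      simp [h3 m n σ g x hx]
    · obtain ⟨f, hf, h⟩ := h4 hk
      exact ⟨_, smooth_smul a hf, fun n σ x v => by simp [h]⟩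

/-- The exterior derivative, computed in every smooth simplex. -/
noncomputable def extD {k : ℕ} (α : Form X k) : Form X (k + 1) :=
  ⟨fun n σ => (stdSimplexIn n).indicator
    (fun x => extDerivWithin (α.1 n σ) (stdSimplexIn n) x), by
    have key : ∀ (n : ℕ) (σ : SSimplex X n) (η : (Fin n → ℝ) → (Fin n → ℝ) [⋀^Fin k]→L[ℝ] ℝ),
        Differentiable ℝ η → (∀ x ∈ stdSimplexIn n, α.1 n σ x = η x) → ∀ x ∈ stdSimplexIn n,
        extDerivWithin (α.1 n σ) (stdSimplexIn n) x = extDeriv η x := by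
      intro n σ η hη h x hx
      rw [extDerivWithin_congr' h hx, extDerivWithin, extDeriv,
        (hη x).fderivWithin (uniqueDiffOn_stdSimplexIn n x hx)]
    refine ⟨fun n σ => ?_, fun n σ x hx => ?_, fun m n σ g x hx => ?_, fun hk => ?_⟩
    · obtain ⟨η, hη, h⟩ := α.2.1 n σ
      refine ⟨extDeriv η, ?_, fun x hx => ?_⟩
      · exact (ContinuousAlternatingMap.alternatizeUncurryFinCLM ℝ (Fin n → ℝ) ℝ).contDiff.comp
          (hη.fderiv_right (m := ∞) (by simp))
      · simp only [Set.indicator_of_mem hx,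
          key n σ η (hη.differentiable (by simp)) h x hx]
    · exact Set.indicator_of_notMem hx _
    · obtain ⟨η, hη, h⟩ := α.2.1 n σ
      have hg := g.mapsTo hx
      have hηd := hη.differentiable (by simp)
      have hc : Differentiable ℝ fun y =>
          (η (g.toFun y)).compContinuousLinearMap (fderiv ℝ g.toFun y) := by
        intro y
        exact ((hηd.comp (g.smooth.differentiable (by simp)) y).hasFDerivAt
          |>.continuousAlternatingMapCompContinuousLinearMap
            ((g.smooth.fderiv_right (m := ∞) (by simp)).differentiable
              (by simp) y).hasFDerivAt).differentiableAt
      simp only [Set.indicator_of_mem hx, Set.indicator_of_mem hg, key n σ η hηd h _ hg]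
      rw [key m (σ.comp g) _ hc (fun y hy => by
        rw [α.2.2.2.1 m n σ g y hy, h _ (g.mapsTo hy)]) x hx]
      exact extDeriv_pullback (r := ∞) (hηd _) g.smooth.contDiffAt (by
        simp only [minSmoothness_of_isRCLikeNormedField]
        exact WithTop.coe_le_coe.2 le_top)
    · exact absurd hk (Nat.succ_ne_zero k)⟩

/-- Pull-back of forms along a smooth map. -/
def Form.pullback {k : ℕ} (φ : SmoothMap A X) : Form X k →ₗ[ℝ] Form A k where
  toFun α := ⟨fun n σ => α.1 n (σ.push φ), fun n σ => α.2.1 n (σ.push φ),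
    fun n σ => α.2.2.1 n (σ.push φ), fun m n σ g => α.2.2.2.1 m n (σ.push φ) g, fun hk => by
      obtain ⟨f, hf, h⟩ := α.2.2.2.2 hk
      exact ⟨f ∘ φ.toFun, φ.smooth f hf, fun n σ => h n (σ.push φ)⟩⟩
  map_add' _ _ := rfl
  map_smul' _ _ := rfl

/-- The integral of an `n`-form over a smooth singular `n`-simplex. -/
noncomputable def Form.integralSimplex {n : ℕ} (α : Form X n) (σ : SSimplex X n) : ℝ :=
  ∫ x in stdSimplexIn n, α.1 n σ x (fun i => Pi.single i 1)

theorem Form.integrableOn {n : ℕ} (α : Form X n) (σ : SSimplex X n) :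
    MeasureTheory.IntegrableOn (fun x => α.1 n σ x (fun i => Pi.single i 1))
      (stdSimplexIn n) := by
  obtain ⟨η, hη, h⟩ := α.2.1 n σ
  have hc : Continuous fun x => η x (fun i => Pi.single i 1) := by
    exact (ContinuousAlternatingMap.apply ℝ _ _ (fun i => Pi.single i 1)).continuous.comp
      hη.continuous
  refine MeasureTheory.IntegrableOn.congr_fun
    (hc.continuousOn.integrableOn_compact (isCompact_stdSimplexIn n))
    (fun x hx => by simp only [h x hx]) (isCompact_stdSimplexIn n).measurableSet

/-! ### Chain complexes of abelian groups -/

/-- A chain complex of abelian groups in degrees `≥ 0`. -/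
structure AbComplex where
  C : ℕ → Type w
  [grp : ∀ n, AddCommGroup (C n)]
  d : ∀ n, C (n + 1) →+ C n
  d_d : ∀ n c, d n (d (n + 1) c) = 0

namespace AbComplex

instance (K : AbComplex.{w}) (n : ℕ) : AddCommGroup (K.C n) := K.grp n

/-- Chain maps. -/
structure Hom (K : AbComplex.{u}) (L : AbComplex.{v}) where
  f : ∀ n, K.C n →+ L.C n
  comm : ∀ n c, f n (K.d n c) = L.d n (f (n + 1) c)

/-- The group of `n`-cycles. -/
def cycles (K : AbComplex.{w}) : ∀ n, AddSubgroup (K.C n)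
  | 0 => ⊤
  | n + 1 => (K.d n).ker

theorem d_mem_cycles (K : AbComplex.{w}) (n : ℕ) (c : K.C (n + 1)) : K.d n c ∈ K.cycles n := by
  cases n with
  | zero => exact AddSubgroup.mem_top _
  | succ n => exact K.d_d n c

/-- The boundary operator, with values in the group of cycles. -/
def bd (K : AbComplex.{w}) (n : ℕ) : K.C (n + 1) →+ K.cycles n :=
  (K.d n).codRestrict (K.cycles n) (K.d_mem_cycles n)

theorem Hom.map_mem_cycles {K : AbComplex.{u}} {L : AbComplex.{v}} (F : K.Hom L) (n : ℕ)
    (c : K.C n) (hc : c ∈ K.cycles n) : F.f n c ∈ L.cycles n := by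
  cases n with
  | zero => exact AddSubgroup.mem_top _
  | succ n =>
    have hc : K.d n c = 0 := hc
    change L.d n (F.f (n + 1) c) = 0
    rw [← F.comm, hc, map_zero]

/-- The map induced on cycles. -/
def Hom.cyclesMap {K : AbComplex.{u}} {L : AbComplex.{v}} (F : K.Hom L) (n : ℕ) :
    K.cycles n →+ L.cycles n :=
  ((F.f n).comp (K.cycles n).subtype).codRestrict (L.cycles n)
    fun c => F.map_mem_cycles n c c.2

variable (G : Type w) [AddCommGroup G]

/-- The coboundary operator `δμ = μ ∘ ∂`. -/
def coboundary (K : AbComplex.{u}) (n : ℕ) : (K.C n →+ G) →+ (K.C (n + 1) →+ G) where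
  toFun μ := μ.comp (K.d n)
  map_zero' := rfl
  map_add' _ _ := rfl

/-- `n`-cocycles with coefficients in `G`. -/
def cocycles (K : AbComplex.{u}) (n : ℕ) : AddSubgroup (K.C n →+ G) := (K.coboundary G n).ker

/-- `n`-coboundaries with coefficients in `G`. -/
def coboundaries (K : AbComplex.{u}) : ∀ n, AddSubgroup (K.C n →+ G)
  | 0 => ⊥
  | n + 1 => (K.coboundary G n).range

/-- The cohomology group `H^n(K; G)`. -/
abbrev Cohomology (K : AbComplex.{u}) (n : ℕ) : Type (max u w) :=
  K.cocycles G n ⧸ (K.coboundaries G n).addSubgroupOf (K.cocycles G n)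

/-- The map induced on cocycles. -/
def Hom.cocyclesMap {K : AbComplex.{u}} {L : AbComplex.{v}} (F : K.Hom L) (n : ℕ) :
    L.cocycles G n →+ K.cocycles G n where
  toFun μ := ⟨μ.1.comp (F.f n), by
    have h : ∀ c, μ.1 (L.d n c) = 0 := DFunLike.congr_fun μ.2
    refine AddMonoidHom.ext fun c => ?_
    change μ.1 (F.f n (K.d n c)) = 0
    rw [F.comm, h]⟩
  map_zero' := rfl
  map_add' _ _ := rfl

/-- The map induced on cohomology. -/
def Hom.cohomologyMap {K : AbComplex.{u}} {L : AbComplex.{v}} (F : K.Hom L) (n : ℕ) :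
    L.Cohomology G n →+ K.Cohomology G n :=
  QuotientAddGroup.map _ _ (F.cocyclesMap G n) (by
    rintro ⟨μ, hμ⟩ h
    cases n with
    | zero =>
      have h : μ = 0 := h
      subst h
      exact rfl
    | succ n =>
      obtain ⟨s, hs⟩ := h
      have hs : s.comp (L.d n) = μ := hs
      refine ⟨s.comp (F.f n), AddMonoidHom.ext fun c => ?_⟩
      change s (F.f n (K.d n c)) = μ (F.f (n + 1) c)
      rw [F.comm, ← hs]
      rfl)

end AbComplex

/-! ### Smooth singular chains -/

theorem SSimplex.face_face {n : ℕ} (σ : SSimplex X (n + 2)) {i j : Fin (n + 2)} (h : i ≤ j) :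
    (σ.face j.succ).face i = (σ.face i.castSucc).face j := by
  have h1 : (j.succ.succAbove ∘ i.succAbove : Fin (n + 1) → Fin (n + 3)) =
      i.castSucc.succAbove ∘ j.succAbove := by
    funext x
    have := DFunLike.congr_fun
      (congrArg SimplexCategory.Hom.toOrderHom (SimplexCategory.δ_comp_δ h)) x
    exact this
  have h2 : ∀ x : Fin n → ℝ, vertexMapFun j.succ.succAbove (vertexMapFun i.succAbove x) =
      vertexMapFun i.castSucc.succAbove (vertexMapFun j.succAbove x) := fun x => by
    rw [vertexMapFun_comp, vertexMapFun_comp, h1]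
  refine SSimplex.ext (funext fun x => ?_)
  exact congrArg σ.toFun (Subtype.ext (h2 x))

/-- The group `C_n(X; ℤ)` of smooth singular chains. -/
abbrev Chain (X : Type u) [DifferentialSpace X] (n : ℕ) : Type u := SSimplex X n →₀ ℤ

/-- The boundary operator `∂σ = ∑ (-1)^i σ ∘ δ_i`. -/
noncomputable def boundary (X : Type u) [DifferentialSpace X] (n : ℕ) :
    Chain X (n + 1) →+ Chain X n :=
  ∑ i : Fin (n + 2), (-1 : ℤ) ^ (i : ℕ) •
    Finsupp.mapDomain.addMonoidHom (fun σ : SSimplex X (n + 1) => σ.face i)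

theorem boundary_single (n : ℕ) (σ : SSimplex X (n + 1)) :
    boundary X n (Finsupp.single σ 1) =
      ∑ i : Fin (n + 2), (-1 : ℤ) ^ (i : ℕ) • Finsupp.single (σ.face i) (1 : ℤ) := by
  simp [boundary, Finsupp.mapDomain_single]

theorem boundary_boundary (n : ℕ) (c : Chain X (n + 2)) :
    boundary X n (boundary X (n + 1) c) = 0 := by
  suffices h : (boundary X n).comp (boundary X (n + 1)) = 0 from DFunLike.congr_fun h c
  refine Finsupp.addHom_ext' fun σ => AddMonoidHom.ext_int ?_
  change boundary X n (boundary X (n + 1) (Finsupp.single σ 1)) = 0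
  rw [boundary_single, map_sum]
  simp only [map_zsmul, boundary_single, Finset.smul_sum, smul_smul]
  rw [← Finset.sum_product']
  let P := Fin (n + 3) × Fin (n + 2)
  let S : Finset P := {ij : P | (ij.1 : ℕ) ≤ (ij.2 : ℕ)}
  rw [Finset.univ_product_univ, ← Finset.sum_add_sum_compl S, ← eq_neg_iff_add_eq_zero,
    ← Finset.sum_neg_distrib]
  let f : ∀ ij : P, ij ∈ S → P := fun ij hij =>
    (ij.2.succ, Fin.castLT ij.1 (lt_of_le_of_lt (Finset.mem_filter.mp hij).right (Fin.is_lt ij.2)))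
  apply Finset.sum_bij f
  · intro ij hij
    simp_rw [S, f, Finset.compl_filter, Finset.mem_filter_univ, Fin.val_succ,
      Fin.val_castLT] at hij ⊢
    lia
  · rintro ⟨i, j⟩ hij ⟨i', j'⟩ hij' h
    have h1 := congrArg (fun p : P => (p.1 : ℕ)) h
    have h2 := congrArg (fun p : P => (p.2 : ℕ)) h
    refine Prod.ext (Fin.ext ?_) (Fin.ext ?_)
    · simpa [f] using h2
    · simpa [f] using h1
  · rintro ⟨i', j'⟩ hij'
    simp_rw [S, Finset.compl_filter, Finset.mem_filter_univ, not_le] at hij'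
    refine ⟨(Fin.castSucc j', i'.pred ?_), ?_, ?_⟩
    · rintro rfl
      simp at hij'
    · simp [S]
      lia
    · simp [f]
  · rintro ⟨i, j⟩ hij
    have hle : (i : ℕ) ≤ j := by simpa [S] using hij
    obtain ⟨i, rfl⟩ : ∃ i' : Fin (n + 2), i'.castSucc = i :=
      ⟨i.castLT (lt_of_le_of_lt hle j.2), Fin.castSucc_castLT _ _⟩
    simp only [f, Fin.castLT_castSucc, Fin.val_succ, Fin.val_castSucc]
    rw [SSimplex.face_face σ (i := i) (j := j) (show i ≤ j from hle), ← neg_smul]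
    congr 1
    ring

/-- The smooth singular chain complex of `X`. -/
noncomputable def singular (X : Type u) [DifferentialSpace X] : AbComplex.{u} where
  C := Chain X
  d := boundary X
  d_d := boundary_boundary

/-- The chain map `φ_*`. -/
noncomputable def pushforward (φ : SmoothMap A X) : (singular A).Hom (singular X) where
  f _ := Finsupp.mapDomain.addMonoidHom (SSimplex.push φ)
  comm n c := by
    suffices h : (Finsupp.mapDomain.addMonoidHom (SSimplex.push φ)).comp (boundary A n) =
      (boundary X n).comp (Finsupp.mapDomain.addMonoidHom (SSimplex.push φ)) from
      DFunLike.congr_fun h c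
    refine Finsupp.addHom_ext' fun σ => AddMonoidHom.ext_int ?_
    change Finsupp.mapDomain.addMonoidHom (SSimplex.push φ) (boundary A n (Finsupp.single σ 1)) =
      boundary X n (Finsupp.mapDomain (SSimplex.push φ) (Finsupp.single σ 1))
    rw [boundary_single, Finsupp.mapDomain_single, boundary_single, map_sum]
    simp only [map_zsmul, Finsupp.mapDomain.addMonoidHom_apply, Finsupp.mapDomain_single]
    rfl

/-- The integral `∫_c α` of an `n`-form over a smooth singular `n`-chain. -/
noncomputable def Form.integral {n : ℕ} : Form X n →+ ((singular X).C n →+ ℝ) :=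
  (Finsupp.liftAddHom (α := SSimplex X n) (M := ℤ) (N := ℝ)).toAddMonoidHom.comp
    { toFun := fun α σ => zmultiplesHom ℝ (Form.integralSimplex α σ)
      map_zero' := by
        funext σ
        refine AddMonoidHom.ext_int ?_
        simp [Form.integralSimplex]
      map_add' := fun α β => by
        funext σ
        refine AddMonoidHom.ext_int ?_
        have : Form.integralSimplex (α + β) σ =
            Form.integralSimplex α σ + Form.integralSimplex β σ :=
          MeasureTheory.integral_add (Form.integrableOn α σ) (Form.integrableOn β σ)
        simp [this] }

theorem Form.integral_single {n : ℕ} (α : Form X n) (σ : SSimplex X n) (a : ℤ) :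
    Form.integral α (Finsupp.single σ a : Chain X n) = a * Form.integralSimplex α σ := by
  change Finsupp.liftAddHom (fun σ => zmultiplesHom ℝ (Form.integralSimplex α σ))
    (Finsupp.single σ a) = _
  simp

/-- The de Rham theorem for `X`: integration of differential forms induces an isomorphism from de
Rham cohomology to smooth singular cohomology with real coefficients. -/
structure DeRhamTheorem (X : Type u) [DifferentialSpace X] : Prop where
  surjective : ∀ (k : ℕ), ∀ μ ∈ (singular X).cocycles ℝ k, ∃ α : Form X k, extD α = 0 ∧
    Form.integral α - μ ∈ (singular X).coboundaries ℝ k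
  injective_zero : ∀ α : Form X 0, extD α = 0 →
    Form.integral α ∈ (singular X).coboundaries ℝ 0 → α = 0
  injective_succ : ∀ (k : ℕ) (α : Form X (k + 1)), extD α = 0 →
    Form.integral α ∈ (singular X).coboundaries ℝ (k + 1) → ∃ β : Form X k, extD β = α

theorem Form.integral_neg {n : ℕ} (α : Form X n) : Form.integral (-α) = -Form.integral α :=
  map_neg (Form.integral (X := X) (n := n)) α

/-! ### Homomorphisms to `U(1)` -/

/-- The homomorphism `t ↦ exp (2πit)` from `ℝ` to `U(1)`; the latter is written additively. -/
noncomputable def e : ℝ →+ Additive Circle := Circle.expHom.comp (AddMonoidHom.mulLeft (2 * Real.pi))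

theorem e_eq_zero_iff (t : ℝ) : e t = 0 ↔ ∃ n : ℤ, t = n := by
  change Circle.exp (2 * Real.pi * t) = 1 ↔ _
  rw [Circle.exp_eq_one]
  refine exists_congr fun n => ?_
  rw [mul_comm]
  exact mul_left_inj' (by positivity)

theorem e_surjective : Function.Surjective e := by
  intro z
  obtain ⟨t, ht⟩ := Circle.exp_surjective z.toMul
  refine ⟨t / (2 * Real.pi), ?_⟩
  change Additive.ofMul (Circle.exp (2 * Real.pi * (t / (2 * Real.pi)))) = z
  rw [mul_div_cancel₀ _ (by positivity), ht]
  rfl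

/-- Homomorphisms to `U(1)` extend along injective homomorphisms. -/
theorem exists_extension {M : Type u} {N : Type v} [AddCommGroup M] [AddCommGroup N] (f : M →+ N)
    (hf : Function.Injective f) (g : M →+ Additive Circle) :
    ∃ g' : N →+ Additive Circle, ∀ x, g' (f x) = g x := by
  choose l hl using e_surjective
  let _ : DivisibleBy (Additive Circle) ℤ :=
    { div := fun a n => if n = 0 then 0 else e (l a / n)
      div_zero := fun a => by simp
      div_cancel := fun {n} a hn => by
        rw [if_neg hn, ← map_zsmul, zsmul_eq_mul, mul_div_cancel₀ _ (by exact_mod_cast hn), hl] }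
  obtain ⟨g', h⟩ := (Module.Baer.of_divisible (Additive Circle)).extension_property_addMonoidHom
    f hf g
  exact ⟨g', DFunLike.congr_fun h⟩

/-- Homomorphisms from a group of chains to `U(1)` lift to `ℝ`. -/
theorem exists_lift_chain {n : ℕ} (g : (singular X).C n →+ Additive Circle) :
    ∃ T : (singular X).C n →+ ℝ, ∀ c, e (T c) = g c := by
  choose l hl using e_surjective
  let T : Chain X n →+ ℝ :=
    Finsupp.liftAddHom fun σ => zmultiplesHom ℝ (l (g (Finsupp.single σ 1 : Chain X n)))
  refine ⟨T, fun c => ?_⟩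
  have h : e.comp T = g := by
    refine Finsupp.addHom_ext' fun σ => AddMonoidHom.ext_int ?_
    change e (T (Finsupp.single σ 1)) = g (Finsupp.single σ 1 : Chain X n)
    simp [T, hl]
  exact DFunLike.congr_fun h c

/-- Homomorphisms from a group of cycles to `U(1)` have real lifts. -/
theorem exists_lift {n : ℕ} (h : (singular X).cycles n →+ Additive Circle) :
    ∃ T : (singular X).cycles n →+ ℝ, ∀ z, e (T z) = h z := by
  obtain ⟨g, hg⟩ := exists_extension ((singular X).cycles n).subtype
    Subtype.val_injective h
  obtain ⟨T, hT⟩ := exists_lift_chain g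
  exact ⟨T.comp ((singular X).cycles n).subtype, fun z => (hT z).trans (hg z)⟩

/-- An integer valued homomorphism on cycles extends to an integral cochain. -/
theorem exists_int_extension {n : ℕ} (T : (singular X).cycles n →+ ℝ)
    (hT : ∀ z, e (T z) = 0) :
    ∃ t : (singular X).C n →+ ℤ, ∀ z : (singular X).cycles n, (t z : ℝ) = T z := by
  -- the projection of the chains to the boundaries splits since the latter form a free group;
  -- instead of a splitting we use that chains are free and `ℝ`, `U(1)` are divisible
  obtain ⟨R, hR⟩ : ∃ R : (singular X).C n →+ ℝ, ∀ z : (singular X).cycles n, R z = T z := by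
    obtain ⟨R, hR⟩ := (Module.Baer.of_divisible ℝ).extension_property_addMonoidHom
      ((singular X).cycles n).subtype Subtype.val_injective T
    exact ⟨R, DFunLike.congr_fun hR⟩
  obtain ⟨S, hS⟩ : ∃ S : (singular X).C n →+ ℝ, (∀ z : (singular X).cycles n, S z = 0) ∧
      ∀ c, e (S c) = e (R c) := by
    cases n with
    | zero =>
      refine ⟨0, fun _ => rfl, fun c => ?_⟩
      have := hT ⟨c, AddSubgroup.mem_top _⟩
      rw [← hR] at this
      rw [this]; simp
    | succ n =>
      let E := (singular X).d n
      have hker : ∀ c ∈ E.ker, (e.comp R) c = 0 := fun c hc => by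
        have h1 := hT ⟨c, hc⟩
        rw [← hR] at h1
        exact h1
      let q : (singular X).C (n + 1) ⧸ E.ker →+ Additive Circle :=
        QuotientAddGroup.lift E.ker (e.comp R) hker
      obtain ⟨g, hg⟩ := exists_extension (QuotientAddGroup.kerLift E)
        (QuotientAddGroup.kerLift_injective E) q
      obtain ⟨U, hU⟩ := exists_lift_chain g
      refine ⟨U.comp E, fun z => ?_, fun c => ?_⟩
      · have hz : E z = 0 := z.2
        change U (E z) = 0
        rw [hz, map_zero]
      · exact (hU _).trans (hg (QuotientAddGroup.mk c))
  have hint : ∀ c, ∃ m : ℤ, (R - S) c = m := fun c => by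
    rw [← e_eq_zero_iff, AddMonoidHom.sub_apply, map_sub, hS.2, sub_self]
  choose t ht using hint
  refine ⟨⟨⟨t, ?_⟩, fun a b => ?_⟩, fun z => ?_⟩
  · exact_mod_cast (ht 0).symm.trans (map_zero _)
  · have := ht (a + b)
    rw [map_add, ht, ht] at this
    exact_mod_cast this.symm
  · change (t z : ℝ) = T z
    rw [← ht, AddMonoidHom.sub_apply, hS.1, sub_zero, hR]

/-! ### Integrals over shrinking simplices -/

/-- The homothety `x ↦ tx` of the standard simplex. -/
def scale (n : ℕ) (t : ℝ) (ht : t ∈ Set.Icc (0 : ℝ) 1) : SimplexMap n n where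
  toFun x := t • x
  smooth := contDiff_const_smul t
  mapsTo x hx := by
    have := (convex_stdSimplexIn n) hx (zero_mem_stdSimplexIn n) ht.1 (sub_nonneg.2 ht.2)
      (add_sub_cancel t 1)
    simpa using this

theorem SSimplex.comp_scale_one {n : ℕ} (σ : SSimplex X n) :
    σ.comp (scale n 1 ⟨zero_le_one, le_rfl⟩) = σ := by
  refine SSimplex.ext (funext fun x => congrArg σ.toFun (Subtype.ext ?_))
  exact one_smul ℝ (x : Fin n → ℝ)

theorem exists_continuous_integral {m n : ℕ} (α : Form X (m + 1)) (σ : SSimplex X n)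
    (g : SimplexMap (m + 1) n) : ∃ F : ℝ → ℝ, Continuous F ∧ F 0 = 0 ∧
      ∀ t ht, Form.integralSimplex α ((σ.comp (scale n t ht)).comp g) = F t := by
  obtain ⟨η, hη, h⟩ := α.2.1 n σ
  let H : ℝ → (Fin (m + 1) → ℝ) → ℝ := fun t x =>
    η (t • g.toFun x) (fun i => t • fderiv ℝ g.toFun x (Pi.single i 1))
  have hH : Continuous H.uncurry := by
    have h1 : Continuous fun p : ℝ × (Fin (m + 1) → ℝ) => η (p.1 • g.toFun p.2) :=
      hη.continuous.comp (continuous_fst.smul (g.smooth.continuous.comp continuous_snd))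
    have h2 : Continuous fun p : ℝ × (Fin (m + 1) → ℝ) => fun i : Fin (m + 1) =>
        p.1 • fderiv ℝ g.toFun p.2 (Pi.single i 1) := by
      refine continuous_pi fun i => continuous_fst.smul ?_
      exact ((g.smooth.continuous_fderiv (by simp)).comp continuous_snd).clm_apply
        continuous_const
    exact ((ContinuousAlternatingMap.toContinuousMultilinearMapCLM ℝ).continuous.comp h1).eval h2
  refine ⟨fun t => ∫ x in stdSimplexIn (m + 1), H t x,
    continuous_parametric_integral_of_continuous hH (isCompact_stdSimplexIn _), ?_, ?_⟩
  · refine MeasureTheory.integral_eq_zero_of_ae (Filter.Eventually.of_forall fun x => ?_)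
    exact (η _).map_coord_zero 0 (zero_smul ℝ _)
  · intro t ht
    refine MeasureTheory.setIntegral_congr_fun (isCompact_stdSimplexIn _).measurableSet
      fun x hx => ?_
    have hgx := g.mapsTo hx
    have hs : fderiv ℝ (scale n t ht).toFun (g.toFun x) = t • ContinuousLinearMap.id ℝ _ := by
      change fderiv ℝ (fun y : Fin n → ℝ => t • y) _ = _
      rw [fderiv_fun_const_smul differentiableAt_fun_id, fderiv_fun_id]
    simp only [H]
    rw [α.2.2.2.1 _ _ _ g x hx, α.2.2.2.1 _ _ σ (scale n t ht) _ hgx, hs,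
      h _ ((scale n t ht).mapsTo hgx)]
    simp [ContinuousAlternatingMap.compContinuousLinearMap_apply, Function.comp_def, scale]

theorem eq_zero_of_int_valued {F : ℝ → ℝ} (hF : Continuous F) (h0 : F 0 = 0)
    (hint : ∀ t ∈ Set.Icc (0 : ℝ) 1, ∃ n : ℤ, F t = n) : F 1 = 0 := by
  by_contra h1
  obtain ⟨n, hn⟩ := hint 1 ⟨zero_le_one, le_rfl⟩
  have hn0 : n ≠ 0 := by
    rintro rfl
    exact h1 (by simpa using hn)
  have h2 : (1 / 2 : ℝ) ∈ Set.Icc |F 0| |F 1| := by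
    refine ⟨by simp [h0], ?_⟩
    rw [hn]
    have : (1 : ℝ) ≤ |(n : ℝ)| := by exact_mod_cast Int.one_le_abs hn0
    linarith
  obtain ⟨t, ht, htF⟩ := intermediate_value_Icc zero_le_one hF.abs.continuousOn h2
  obtain ⟨m, hm⟩ := hint t ht
  simp only [hm] at htF
  have h3 : (2 * |m| : ℤ) = 1 := by
    have : (2 * |(m : ℝ)|) = 1 := by rw [htF]; norm_num
    exact_mod_cast this
  omega

/-- A form with integral values on all chains has zero integrals. -/
theorem integral_eq_zero_of_int {m : ℕ} (α : Form X (m + 1))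
    (h : ∀ c, e (Form.integral α c) = 0) : Form.integral α = 0 := by
  refine Finsupp.addHom_ext' fun σ => AddMonoidHom.ext_int ?_
  change Form.integral α (Finsupp.single σ 1 : Chain X (m + 1)) = 0
  rw [Form.integral_single, Int.cast_one, one_mul]
  have hid : ∀ ht, (σ.comp (scale _ 1 ht)).comp (scale _ 1 ht) = σ := fun ht => by
    rw [SSimplex.comp_scale_one, SSimplex.comp_scale_one]
  obtain ⟨F, hF, h0, hFt⟩ := exists_continuous_integral α σ
    (scale _ 1 ⟨zero_le_one, le_rfl⟩)
  have h1 := eq_zero_of_int_valued hF h0 fun t ht => by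
    have := h (Finsupp.single ((σ.comp (scale _ t ht)).comp
      (scale _ 1 ⟨zero_le_one, le_rfl⟩)) 1 : Chain X (m + 1))
    rw [Form.integral_single, Int.cast_one, one_mul, hFt, e_eq_zero_iff] at this
    exact this
  have hone : (1 : ℝ) ∈ Set.Icc (0 : ℝ) 1 := ⟨zero_le_one, le_rfl⟩
  rw [← hid hone]
  exact (hFt 1 hone).trans h1

/-- A form with integral values on all boundaries has zero integrals over boundaries. -/
theorem integral_d_eq_zero_of_int {m : ℕ} (α : Form X (m + 1))
    (h : ∀ b, e (Form.integral α ((singular X).d (m + 1) b)) = 0) :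
    ∀ b, Form.integral α ((singular X).d (m + 1) b) = 0 := by
  suffices h' : (Form.integral α).comp ((singular X).d (m + 1)) = 0 from DFunLike.congr_fun h'
  refine Finsupp.addHom_ext' fun σ => AddMonoidHom.ext_int ?_
  have hb : ∀ τ : SSimplex X (m + 2), Form.integral α ((singular X).d (m + 1)
      (Finsupp.single τ 1 : Chain X (m + 2))) =
      ∑ i : Fin (m + 3), (-1 : ℤ) ^ (i : ℕ) • Form.integralSimplex α (τ.face i) := fun τ => by
    have hΦ : ∀ Φ : Chain X (m + 1) →+ ℝ, Φ (boundary X (m + 1) (Finsupp.single τ 1)) =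
        ∑ i : Fin (m + 3), (-1 : ℤ) ^ (i : ℕ) • Φ (Finsupp.single (τ.face i) 1) := fun Φ => by
      rw [boundary_single, map_sum]
      exact Finset.sum_congr rfl fun i _ => map_zsmul _ _ _
    refine (hΦ (Form.integral α)).trans (Finset.sum_congr rfl fun i _ => congrArg _ ?_)
    exact (Form.integral_single α (τ.face i) 1).trans (by simp)
  change Form.integral α ((singular X).d (m + 1) (Finsupp.single σ 1 : Chain X (m + 2))) = 0
  choose F hF h0 hFt using fun i : Fin (m + 3) =>
    exists_continuous_integral α σ (vertexMap i.succAbove)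
  have hsum : ∀ t ht, Form.integral α ((singular X).d (m + 1)
      (Finsupp.single (σ.comp (scale _ t ht)) 1 : Chain X (m + 2))) =
      ∑ i : Fin (m + 3), (-1 : ℤ) ^ (i : ℕ) • F i t := fun t ht => by
    rw [hb]
    exact Finset.sum_congr rfl fun i _ => congrArg _ (hFt i t ht)
  have h1 := eq_zero_of_int_valued (F := fun t => ∑ i : Fin (m + 3), (-1 : ℤ) ^ (i : ℕ) • F i t)
    (continuous_finsetSum _ fun i _ => (hF i).fun_const_smul _) (by simp [h0]) fun t ht => by
      rw [← e_eq_zero_iff, ← hsum t ht]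
      exact h _
  rw [← h1, ← hsum 1 ⟨zero_le_one, le_rfl⟩, SSimplex.comp_scale_one]

/-! ### Differential characters -/

/-- `h ∘ ∂ = exp (2πi ∫ α)`: the form `α` is the curvature of the homomorphism `h`. -/
def HasCurvature {n : ℕ} (h : (singular X).cycles n →+ Additive Circle) (α : Form X (n + 1)) :
    Prop :=
  ∀ c, h ((singular X).bd n c) = e (Form.integral α c)

/-- The group of differential characters of degree `n + 1`. -/
noncomputable def diffChar (X : Type u) [DifferentialSpace X] (n : ℕ) :
    AddSubgroup ((singular X).cycles n →+ Additive Circle) where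
  carrier := {h | ∃ α : Form X (n + 1), HasCurvature h α}
  zero_mem' := ⟨0, fun c => by simp⟩
  add_mem' := by
    rintro h h' ⟨α, hα⟩ ⟨β, hβ⟩
    exact ⟨α + β, fun c => by simp [hα c, hβ c]⟩
  neg_mem' := by
    rintro h ⟨α, hα⟩
    have hn := Form.integral_neg α
    exact ⟨-α, fun c => by
      rw [hn, AddMonoidHom.neg_apply, hα]
      exact (map_neg e _).symm⟩

/-- The subgroup of flat differential characters of degree `n + 1`, those with curvature zero. -/
noncomputable def flatChar (X : Type u) [DifferentialSpace X] (n : ℕ) :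
    AddSubgroup (diffChar X n) where
  carrier := {h | HasCurvature h.1 0}
  zero_mem' := fun c => by simp
  add_mem' := by
    intro h h' hα hβ c
    simp [hα c, hβ c]
  neg_mem' := by
    intro h hα c
    simp [hα c]

/-- The integral cocycle `μ` is of the form `c ↦ ∫_c α - T(∂c)`, where `α` is the curvature and
`T` a real lift of the differential character `h`. -/
def IsCharCocycle {n : ℕ} (h : diffChar X n) (μ : (singular X).cocycles ℤ (n + 1)) : Prop :=
  ∃ (α : Form X (n + 1)) (T : (singular X).cycles n →+ ℝ), HasCurvature h.1 α ∧
    (∀ z, e (T z) = h.1 z) ∧ ∀ c, (μ.1 c : ℝ) = Form.integral α c - T ((singular X).bd n c)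

theorem exists_isCharCocycle {n : ℕ} (h : diffChar X n) : ∃ μ, IsCharCocycle h μ := by
  obtain ⟨h, α, hα⟩ := h
  obtain ⟨T, hT⟩ := exists_lift h
  have hint : ∀ c, ∃ m : ℤ, Form.integral α c - T ((singular X).bd n c) = m := fun c => by
    rw [← e_eq_zero_iff, map_sub, hT, hα, sub_self]
  have hbd : ∀ b, (singular X).bd n ((singular X).d (n + 1) b) = 0 := fun b =>
    Subtype.ext ((singular X).d_d n b)
  have hd := integral_d_eq_zero_of_int α fun b => by rw [← hα, hbd, map_zero]
  choose μ hμ using hint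
  refine ⟨⟨⟨⟨μ, ?_⟩, fun a b => ?_⟩, AddMonoidHom.ext fun b => ?_⟩, α, T, hα, hT,
    fun c => (hμ c).symm⟩
  · have := hμ 0
    rw [map_zero, map_zero, map_zero, sub_zero] at this
    exact_mod_cast this.symm
  · have := hμ (a + b)
    rw [map_add, map_add, map_add, add_sub_add_comm, hμ, hμ] at this
    exact_mod_cast this.symm
  · have := hμ ((singular X).d (n + 1) b)
    rw [hd, hbd, map_zero, sub_zero] at this
    change μ ((singular X).d (n + 1) b) = 0
    exact_mod_cast this.symm

/-- The class of the cocycle depends neither on the curvature form nor on the lift. -/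
theorem IsCharCocycle.unique {n : ℕ} {h : diffChar X n} {μ ν : (singular X).cocycles ℤ (n + 1)}
    (hμ : IsCharCocycle h μ) (hν : IsCharCocycle h ν) :
    (QuotientAddGroup.mk μ : (singular X).Cohomology ℤ (n + 1)) = QuotientAddGroup.mk ν := by
  obtain ⟨α, T, hα, hT, hμ⟩ := hμ
  obtain ⟨β, S, hβ, hS, hν⟩ := hν
  have hαβ : Form.integral α = Form.integral β := by
    rw [← sub_eq_zero, ← map_sub]
    refine integral_eq_zero_of_int _ fun c => ?_
    rw [map_sub, AddMonoidHom.sub_apply, map_sub, ← hα, ← hβ, sub_self]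
  obtain ⟨t, ht⟩ := exists_int_extension (T - S) fun z => by
    rw [AddMonoidHom.sub_apply, map_sub, hT, hS, sub_self]
  rw [QuotientAddGroup.eq]
  refine ⟨t, AddMonoidHom.ext fun c => ?_⟩
  have h1 : ((t ((singular X).bd n c) : ℤ) : ℝ) = ((-μ.1 c + ν.1 c : ℤ) : ℝ) := by
    rw [ht]
    push_cast
    rw [hμ, hν, hαβ, AddMonoidHom.sub_apply]
    ring
  exact Int.cast_injective h1

/-- The characteristic class of a differential character. -/
noncomputable def charClass (X : Type u) [DifferentialSpace X] (n : ℕ) :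
    diffChar X n →+ (singular X).Cohomology ℤ (n + 1) :=
  AddMonoidHom.mk' (fun h => QuotientAddGroup.mk (Classical.choose (exists_isCharCocycle h)))
    (fun h h' => by
      rw [← QuotientAddGroup.mk_add]
      refine (Classical.choose_spec (exists_isCharCocycle (h + h'))).unique ?_
      obtain ⟨α, T, hα, hT, hμ⟩ := Classical.choose_spec (exists_isCharCocycle h)
      obtain ⟨β, S, hβ, hS, hν⟩ := Classical.choose_spec (exists_isCharCocycle h')
      refine ⟨α + β, T + S, fun c => ?_, fun z => ?_, fun c => ?_⟩
      · rw [map_add, AddMonoidHom.add_apply, map_add, ← hα, ← hβ]; rfl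
      · rw [AddMonoidHom.add_apply, map_add, hT, hS]; rfl
      · have : (((Classical.choose (exists_isCharCocycle h)).1 c +
            (Classical.choose (exists_isCharCocycle h')).1 c : ℤ) : ℝ) = _ :=
          Int.cast_add _ _
        rw [hμ, hν] at this
        refine Eq.trans this ?_
        rw [map_add, AddMonoidHom.add_apply, AddMonoidHom.add_apply]
        ring)

theorem Form.integral_pullback {n : ℕ} (φ : SmoothMap A X) (α : Form X n)
    (c : (singular A).C n) :
    Form.integral (Form.pullback φ α) c = Form.integral α ((pushforward φ).f n c) := by
  suffices h : Form.integral (Form.pullback φ α) =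
    (Form.integral α).comp ((pushforward φ).f n) from DFunLike.congr_fun h c
  refine Finsupp.addHom_ext' fun σ => AddMonoidHom.ext_int ?_
  refine (Form.integral_single (Form.pullback φ α) σ 1).trans ?_
  refine Eq.trans ?_ (congrArg (Form.integral α) (Finsupp.mapDomain_single
    (f := SSimplex.push φ) (a := σ) (b := (1 : ℤ)))).symm
  exact (Form.integral_single α (σ.push φ) 1).symm

/-- The pull-back `φ^*h = h ∘ φ_*` of differential characters of degree `n + 1`. -/
noncomputable def pullbackChar (φ : SmoothMap A X) (n : ℕ) : diffChar X n →+ diffChar A n where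
  toFun h := ⟨h.1.comp ((pushforward φ).cyclesMap n), by
    obtain ⟨α, hα⟩ := h.2
    refine ⟨Form.pullback φ α, fun c => ?_⟩
    rw [Form.integral_pullback, ← hα]
    exact congrArg h.1 (Subtype.ext ((pushforward φ).comm n c))⟩
  map_zero' := rfl
  map_add' _ _ := rfl

/-! ### Mapping cones -/

namespace AbComplex

/-- The groups `K_{n-1}`. -/
def shiftC (K : AbComplex.{u}) : ℕ → Type u
  | 0 => PUnit
  | n + 1 => K.C n

instance (K : AbComplex.{u}) : ∀ n, AddCommGroup (K.shiftC n)
  | 0 => inferInstanceAs (AddCommGroup PUnit)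
  | n + 1 => inferInstanceAs (AddCommGroup (K.C n))

/-- The boundary operator `K_n → K_{n-1}`. -/
def shiftD (K : AbComplex.{u}) : ∀ n, K.C n →+ K.shiftC n
  | 0 => 0
  | n + 1 => K.d n

/-- The mapping cone complex `C_n = L_n × K_{n-1}` of a chain map `F : K → L`, with differential
`∂(s, t) = (∂s + F t, -∂t)`. -/
def cone {K : AbComplex.{u}} {L : AbComplex.{v}} (F : K.Hom L) : AbComplex.{max u v} where
  C n := L.C n × K.shiftC n
  d n := AddMonoidHom.prod
    ((L.d n).comp (AddMonoidHom.fst _ _) + (F.f n).comp (AddMonoidHom.snd (L.C (n + 1)) (K.C n)))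
    (-(K.shiftD n).comp (AddMonoidHom.snd (L.C (n + 1)) (K.C n)))
  d_d n := by
    rintro ⟨s, t⟩
    have h1 : ∀ t : K.C (n + 1),
        L.d n (L.d (n + 1) s + F.f (n + 1) t) + F.f n (-K.d n t) = 0 := fun t => by
      rw [map_add, L.d_d, zero_add, map_neg, F.comm, add_neg_cancel]
    have h2 : ∀ n (t : K.C (n + 1)), -K.shiftD n (-K.d n t) = 0 := fun n t => by
      rw [map_neg, neg_neg]
      cases n with
      | zero => rfl
      | succ n => exact K.d_d n t
    exact Prod.ext (h1 t) (h2 n t)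

/-- The inclusion `s ↦ (s, 0)` of `L` into the mapping cone. -/
def coneIncl {K : AbComplex.{u}} {L : AbComplex.{v}} (F : K.Hom L) : L.Hom (cone F) where
  f n := AddMonoidHom.inl _ _
  comm n c := by
    refine Prod.ext ?_ ?_
    · change L.d n c = L.d n c + F.f n 0
      rw [map_zero, add_zero]
    · change (0 : K.shiftC n) = -K.shiftD n 0
      rw [map_zero, neg_zero]

/-- The projection `(s, t) ↦ t` from the `(n + 1)`-cycles of the cone to the `n`-cycles of `K`. -/
def coneProj {K : AbComplex.{u}} {L : AbComplex.{v}} (F : K.Hom L) (n : ℕ) :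
    (cone F).cycles (n + 1) →+ K.cycles n :=
  ((AddMonoidHom.snd (L.C (n + 1)) (K.C n)).comp ((cone F).cycles (n + 1)).subtype).codRestrict
    (K.cycles n) (by
      rintro ⟨⟨s, t⟩, hz⟩
      cases n with
      | zero => exact AddSubgroup.mem_top _
      | succ n =>
        have h : -K.d n t = 0 := congrArg Prod.snd hz
        exact neg_eq_zero.1 h)

end AbComplex

/-! ### Relative differential characters -/

/-- The mapping cone complex `C_*^φ(X, A; ℤ)` of a smooth map `φ : A → X`. -/
noncomputable abbrev relSingular (φ : SmoothMap A X) : AbComplex.{max v u} :=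
  AbComplex.cone (pushforward φ)

/-- `f(∂_φ(x, y)) = exp (2πi (∫_x α + ∫_y β))` for all relative chains `(x, y)`: the pair `(α, β)`
is the pair of curvature and covariant derivative of `f`. -/
def HasRelCurvature {n : ℕ} {φ : SmoothMap A X}
    (f : (relSingular φ).cycles n →+ Additive Circle) (α : Form X (n + 1)) (β : Form A n) : Prop :=
  ∀ (x : (singular X).C (n + 1)) (y : (singular A).C n),
    f ((relSingular φ).bd n (x, y)) = e (Form.integral α x + Form.integral β y)

/-- The group of relative differential characters of degree `n + 1`. -/
noncomputable def relDiffChar (φ : SmoothMap A X) (n : ℕ) :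
    AddSubgroup ((relSingular φ).cycles n →+ Additive Circle) where
  carrier := {f | ∃ (α : Form X (n + 1)) (β : Form A n), HasRelCurvature f α β}
  zero_mem' := ⟨0, 0, fun x y => by simp⟩
  add_mem' := by
    rintro f f' ⟨α, β, h⟩ ⟨α', β', h'⟩
    refine ⟨α + α', β + β', fun x y => ?_⟩
    rw [AddMonoidHom.add_apply, h, h', ← map_add, add_add_add_comm, map_add Form.integral α,
      map_add Form.integral β]
    rfl
  neg_mem' := by
    rintro f ⟨α, β, h⟩
    have hα := Form.integral_neg α
    have hβ := Form.integral_neg β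
    refine ⟨-α, -β, fun x y => ?_⟩
    rw [AddMonoidHom.neg_apply, h, hα, hβ, AddMonoidHom.neg_apply, AddMonoidHom.neg_apply,
      ← neg_add, map_neg]

/-- The map `i(g)(s, t) = g(t)`, from characters on `A` of degree `n + 1` to relative characters
of degree `n + 2`. -/
noncomputable def charI (φ : SmoothMap A X) (n : ℕ) : diffChar A n →+ relDiffChar φ (n + 1) where
  toFun g := ⟨g.1.comp (AbComplex.coneProj (pushforward φ) n), by
    obtain ⟨α, hα⟩ := g.2
    have hn := Form.integral_neg α
    refine ⟨0, -α, fun x y => ?_⟩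
    have h : AbComplex.coneProj (pushforward φ) n ((relSingular φ).bd (n + 1) (x, y)) =
      -(singular A).bd n y := Subtype.ext rfl
    change g.1 (AbComplex.coneProj (pushforward φ) n ((relSingular φ).bd (n + 1) (x, y))) = _
    rw [h, map_neg, hα, hn, map_zero, AddMonoidHom.zero_apply, AddMonoidHom.neg_apply, zero_add,
      map_neg]⟩
  map_zero' := rfl
  map_add' _ _ := rfl

/-- The map `p(f)(z) = f(z, 0)`, on relative characters of degree `n + 1`. -/
noncomputable def charP (φ : SmoothMap A X) (n : ℕ) : relDiffChar φ n →+ diffChar X n where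
  toFun f := ⟨f.1.comp ((AbComplex.coneIncl (pushforward φ)).cyclesMap n), by
    obtain ⟨α, β, h⟩ := f.2
    refine ⟨α, fun c => ?_⟩
    have h0 := h c 0
    rw [map_zero, add_zero] at h0
    rw [← h0]
    exact congrArg f.1 (Subtype.ext ((AbComplex.coneIncl (pushforward φ)).comm n c))⟩
  map_zero' := rfl
  map_add' _ _ := rfl

/-! ### Differential cohomology in all degrees `k ≥ 0` -/

/-- `Ĥ^k(X; ℤ)`: differential characters for `k ≥ 1`, and `H^0(X; ℤ)` for `k = 0`. -/
def DiffH (X : Type u) [DifferentialSpace X] : ℕ → Type u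
  | 0 => (singular X).Cohomology ℤ 0
  | n + 1 => diffChar X n

noncomputable instance (X : Type u) [DifferentialSpace X] : ∀ k, AddCommGroup (DiffH X k)
  | 0 => inferInstanceAs (AddCommGroup ((singular X).Cohomology ℤ 0))
  | n + 1 => inferInstanceAs (AddCommGroup (diffChar X n))

/-- `Ĥ^k_φ(X, A; ℤ)`: relative differential characters for `k ≥ 1`, and `H^0_φ(X, A; ℤ)` for
`k = 0`. -/
def RelDiffH (φ : SmoothMap A X) : ℕ → Type (max v u)
  | 0 => (relSingular φ).Cohomology ℤ 0
  | n + 1 => relDiffChar φ n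

noncomputable instance (φ : SmoothMap A X) : ∀ k, AddCommGroup (RelDiffH φ k)
  | 0 => inferInstanceAs (AddCommGroup ((relSingular φ).Cohomology ℤ 0))
  | n + 1 => inferInstanceAs (AddCommGroup (relDiffChar φ n))

/-- The characteristic class `c : Ĥ^k(X; ℤ) → H^k(X; ℤ)`, the identity for `k = 0`. -/
noncomputable def DiffH.c (X : Type u) [DifferentialSpace X] :
    ∀ k, DiffH X k →+ (singular X).Cohomology ℤ k
  | 0 => AddMonoidHom.id _
  | n + 1 => charClass X n

/-- The map `p : Ĥ^k_φ(X, A; ℤ) → Ĥ^k(X; ℤ)`. -/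
noncomputable def RelDiffH.p (φ : SmoothMap A X) : ∀ k, RelDiffH φ k →+ DiffH X k
  | 0 => (AbComplex.coneIncl (pushforward φ)).cohomologyMap ℤ 0
  | n + 1 => charP φ n

/-- The subgroup `φ^* Ĥ^{n+1}_flat(X; ℤ)` of `Ĥ^{n+1}(A; ℤ)`. -/
noncomputable def pullbackFlat (φ : SmoothMap A X) (n : ℕ) : AddSubgroup (DiffH A (n + 1)) :=
  (flatChar X n).map (pullbackChar φ n)

/-- The map `i : Ĥ^{n+1}(A; ℤ) → Ĥ^{n+2}_φ(X, A; ℤ)`. -/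
noncomputable def DiffH.i (φ : SmoothMap A X) (n : ℕ) : DiffH A (n + 1) →+ RelDiffH φ (n + 2) :=
  charI φ n

/-- The pull-back `φ^* : H^k(X; ℤ) → H^k(A; ℤ)`. -/
noncomputable def pullbackH (φ : SmoothMap A X) (k : ℕ) :
    (singular X).Cohomology ℤ k →+ (singular A).Cohomology ℤ k :=
  (pushforward φ).cohomologyMap ℤ k

/-- The map `φ^* ∘ c : Ĥ^k(X; ℤ) → φ^* H^k(X; ℤ)`. -/
noncomputable def pullbackC (φ : SmoothMap A X) (k : ℕ) :
    DiffH X k →+ (pullbackH φ k).range :=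
  (pullbackH φ k).rangeRestrict.comp (DiffH.c X k)

end DiffCoh

namespace DiffCoh

universe u v w

/-! ### Affine maps of standard simplices -/

/-! The algebraic half rests on the divisibility of `U(1)`: a homomorphism to `U(1)` extends along
any homomorphism whose kernel it annihilates (`exists_extension_of_ker_le`). A relative character
`(s, t) ↦ g(t)` is trivial exactly when `g` vanishes on those cycles of `A` whose image bounds in
`X`; such a `g` extends to a homomorphism on cycles of `X` modulo boundaries, and these are the flat
characters (`charI_eq_zero_iff`). Likewise a relative character that is trivial on all `(z, 0)`
depends on `t` alone (`exact_charI_charP`).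

The geometric half concerns the characteristic class. For surjectivity, the de Rham theorem on `X`
writes an integral cocycle as `∫ α - T ∘ ∂`, and `exp(2πi T)` is a character with this class
(`charClass_surjective`). If `h = p(f)`, a real lift of `f` on relative cochains gives an integral
cochain `ν` on `A` such that `φ^*μ + δν` is integration of the form `φ^*α - dϑ`; a form of positive
degree with integral values on all chains has zero integrals, so `φ^*μ = -δν`
(`pullbackH_charClass_charP`). Conversely, if `φ^*μ = δν`, extend the lift of `h` to a cochain `S`
on all chains. The cochain `φ^*S + ν` has coboundary `∫ φ^*α`, so by the de Rham theorem on `A` it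
is integration of some `ϑ` up to a coboundary `U ∘ ∂`; then `exp(2πi(S(s) - U(t)))` is the required
relative character (`exists_charP_eq`).

Both directions use Stokes' theorem on smooth chains (`integral_extD`) and the closedness of
curvature (`HasCurvature.extD_eq_zero`); closedness also uses that forms are determined by their
integrals. -/

theorem fderiv_eq_of_affine {E F : Type*} [NormedAddCommGroup E] [NormedSpace ℝ E]
    [NormedAddCommGroup F] [NormedSpace ℝ F] {f : E → F} {x v : E} {w : F}
    (hf : DifferentiableAt ℝ f x) (h : ∀ t : ℝ, f (x + t • v) = f x + t • w) :
    fderiv ℝ f x v = w := by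
  rw [← hf.lineDeriv_eq_fderiv, lineDeriv]
  simp only [h]
  have : HasDerivAt (fun t : ℝ => f x + t • w) ((1 : ℝ) • w) 0 :=
    ((hasDerivAt_id (0 : ℝ)).smul_const w).const_add (f x)
  rw [this.deriv, one_smul]

/-- Barycentric coordinates are affine rather than linear, so their linear part is obtained by
subtracting the value at the origin; the same correction recurs for `vertexMapFun`. -/
theorem bary_add_smul {n : ℕ} (x v : Fin n → ℝ) (t : ℝ) (j : Fin (n + 1)) :
    bary (x + t • v) j = bary x j + t * (bary v j - bary 0 j) := by
  refine Fin.cases ?_ (fun i => ?_) j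
  · simp only [bary, Fin.cons_zero, Pi.add_apply, Pi.smul_apply, smul_eq_mul,
      Finset.sum_add_distrib, ← Finset.mul_sum, Pi.zero_apply, Finset.sum_const_zero]
    ring
  · simp [bary]

theorem vertexMapFun_add_smul {m n : ℕ} (θ : Fin (m + 1) → Fin (n + 1)) (x v : Fin m → ℝ)
    (t : ℝ) : vertexMapFun θ (x + t • v) =
      vertexMapFun θ x + t • (vertexMapFun θ v - vertexMapFun θ 0) := by
  funext l
  simp only [vertexMapFun, bary_add_smul, Pi.add_apply, Pi.smul_apply, Pi.sub_apply, smul_eq_mul,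
    Finset.mul_sum, ← Finset.sum_sub_distrib, ← Finset.sum_add_distrib]
  refine Finset.sum_congr rfl fun j _ => ?_
  split_ifs <;> simp

theorem differentiable_vertexMapFun {m n : ℕ} (θ : Fin (m + 1) → Fin (n + 1)) :
    Differentiable ℝ (vertexMapFun θ) := (vertexMap θ).smooth.differentiable (by simp)

theorem fderiv_vertexMapFun {m n : ℕ} (θ : Fin (m + 1) → Fin (n + 1)) (x v : Fin m → ℝ) :
    fderiv ℝ (vertexMapFun θ) x v = vertexMapFun θ v - vertexMapFun θ 0 :=
  fderiv_eq_of_affine (differentiable_vertexMapFun θ x) (vertexMapFun_add_smul θ x v)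

theorem vertexMapFun_id {n : ℕ} (x : Fin n → ℝ) : vertexMapFun id x = x := by
  funext l
  simp [vertexMapFun, bary]

theorem interior_stdSimplexIn_nonempty (n : ℕ) : (interior (stdSimplexIn n)).Nonempty := by
  by_contra h
  rw [Set.not_nonempty_iff_eq_empty] at h
  -- The test point is the barycentre, where all `n + 1` barycentric coordinates are equal and
  -- positive.
  have h0 := Set.eq_empty_iff_forall_notMem.1 h (fun _ => 1 / (n + 1 : ℝ))
  apply h0
  rw [mem_interior]
  refine ⟨{x | ∀ i, 0 < x i} ∩ {x | ∑ i, x i < 1}, fun x hx => ⟨fun i => (hx.1 i).le, hx.2.le⟩,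
    ?_, ?_, ?_⟩
  · have h1 : IsOpen {x : Fin n → ℝ | ∀ i, 0 < x i} := by
      simp only [Set.ofPred_forall]
      exact isOpen_iInter_of_finite fun i => isOpen_lt continuous_const (continuous_apply i)
    exact h1.inter (isOpen_lt (by fun_prop) continuous_const)
  · intro i; positivity
  · simp only [Set.mem_ofPred_eq, Finset.sum_const, Finset.card_univ, Fintype.card_fin,
      nsmul_eq_mul, mul_one_div]
    rw [div_lt_one (by positivity)]; linarith

theorem volume_real_stdSimplexIn_pos (n : ℕ) :
    0 < MeasureTheory.volume.real (stdSimplexIn n) :=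
  ENNReal.toReal_pos ((MeasureTheory.Measure.measure_pos_of_nonempty_interior _
    (interior_stdSimplexIn_nonempty n)).ne') (isCompact_stdSimplexIn n).measure_lt_top.ne

/-- Permutations of the vertices of a simplex preserve integrals. -/
theorem setIntegral_vertexMapFun_perm {n : ℕ} (θ : Equiv.Perm (Fin (n + 1)))
    (g : (Fin n → ℝ) → ℝ) :
    ∫ x in stdSimplexIn n, g (vertexMapFun θ x) = ∫ x in stdSimplexIn n, g x := by
  have hinv : ∀ (ρ : Equiv.Perm (Fin (n + 1))) (x : Fin n → ℝ),
      vertexMapFun ρ.symm (vertexMapFun ρ x) = x := fun ρ x => by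
    rw [vertexMapFun_comp, Equiv.symm_comp_self, vertexMapFun_id]
  have himage : vertexMapFun θ '' stdSimplexIn n = stdSimplexIn n := by
    refine Set.Subset.antisymm ((vertexMap θ).mapsTo.image_subset) fun x hx => ?_
    exact ⟨vertexMapFun θ.symm x, (vertexMap θ.symm).mapsTo hx, hinv θ.symm x⟩
  have hderiv : ∀ x, fderiv ℝ (vertexMapFun θ) x = fderiv ℝ (vertexMapFun θ) 0 := fun x => by
    ext v : 1
    rw [fderiv_vertexMapFun, fderiv_vertexMapFun]
  have key : ∀ g : (Fin n → ℝ) → ℝ, ∫ x in stdSimplexIn n, g x =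
      |(fderiv ℝ (vertexMapFun θ) 0).det| * ∫ x in stdSimplexIn n, g (vertexMapFun θ x) := by
    intro g
    have := MeasureTheory.integral_image_eq_integral_abs_det_fderiv_smul MeasureTheory.volume
      (isCompact_stdSimplexIn n).measurableSet
      (fun x _ => (differentiable_vertexMapFun θ x).hasFDerivAt.hasFDerivWithinAt)
      (Function.LeftInverse.injective (hinv θ)).injOn g
    rw [himage] at this
    rw [this, ← MeasureTheory.integral_const_mul]
    simp only [hderiv, smul_eq_mul]
  -- The Jacobian is constant. Testing with the constant function `1` compares the positive, finite
  -- volume of the simplex with itself, so the absolute determinant is `1`.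
  have h1 := key fun _ => 1
  rw [MeasureTheory.setIntegral_const, smul_eq_mul, mul_one] at h1
  have hdet : |(fderiv ℝ (vertexMapFun θ) 0).det| = 1 :=
    (mul_eq_right₀ (volume_real_stdSimplexIn_pos n).ne').1 h1.symm
  rw [key g, hdet, one_mul]

/-! ### Stokes' theorem for simplices -/

theorem insertNth_mem_stdSimplexIn_iff {n : ℕ} (i : Fin (n + 1)) (a : ℝ) (y : Fin n → ℝ) :
    i.insertNth a y ∈ stdSimplexIn (n + 1) ↔
      y ∈ stdSimplexIn n ∧ a ∈ Set.Icc 0 (1 - ∑ j, y j) := by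
  simp only [stdSimplexIn, Set.mem_ofPred_eq, Fin.forall_iff_succAbove i, Fin.insertNth_apply_same,
    Fin.insertNth_apply_succAbove, Fin.sum_univ_succAbove _ i, Set.mem_Icc]
  constructor
  · rintro ⟨⟨h1, h2⟩, h3⟩
    exact ⟨⟨h2, by linarith⟩, h1, by linarith⟩
  · rintro ⟨⟨h1, h2⟩, h3, h4⟩
    exact ⟨⟨h3, h1⟩, by linarith⟩

/-- Fubini in the `i`-th coordinate followed by the fundamental theorem of calculus on each fibre
`[0, 1 - ∑ y j]`. The upper endpoints sweep out the slanted face, the lower ones the coordinate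
face. -/
theorem setIntegral_partial_stdSimplexIn {n : ℕ} (i : Fin (n + 1)) {F : (Fin (n + 1) → ℝ) → ℝ}
    (hF : ContDiff ℝ ∞ F) :
    ∫ x in stdSimplexIn (n + 1), fderiv ℝ F x (Pi.single i 1) =
      (∫ y in stdSimplexIn n, F (i.insertNth (1 - ∑ j, y j) y : Fin (n + 1) → ℝ)) -
        ∫ y in stdSimplexIn n, F (i.insertNth 0 y : Fin (n + 1) → ℝ) := by
  have hmeas := fun n => (isCompact_stdSimplexIn n).measurableSet
  have hcont : Continuous fun x => fderiv ℝ F x (Pi.single i 1) :=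
    (hF.continuous_fderiv (by simp)).clm_apply continuous_const
  have hins : Continuous fun p : ℝ × (Fin n → ℝ) =>
      (i.insertNth p.1 p.2 : Fin (n + 1) → ℝ) := by
    fun_prop
  let G := (stdSimplexIn (n + 1)).indicator fun x => fderiv ℝ F x (Pi.single i 1)
  have hG : MeasureTheory.Integrable G :=
    (MeasureTheory.integrable_indicator_iff (hmeas _)).2
      (hcont.continuousOn.integrableOn_compact (isCompact_stdSimplexIn _))
  have hmp := (MeasureTheory.volume_preserving_piFinSuccAbove (fun _ : Fin (n + 1) => ℝ) i).symm
  have hmp_apply : ∀ p : ℝ × (Fin n → ℝ),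
      (MeasurableEquiv.piFinSuccAbove (fun _ : Fin (n + 1) => ℝ) i).symm p =
        i.insertNth p.1 p.2 := fun p => rfl
  rw [← MeasureTheory.integral_indicator (hmeas _)]
  change ∫ x, G x = _
  rw [← hmp.integral_comp' G]
  have hG' : MeasureTheory.Integrable fun p =>
      G ((MeasurableEquiv.piFinSuccAbove (fun _ : Fin (n + 1) => ℝ) i).symm p) :=
    hmp.integrable_comp_of_integrable hG
  rw [MeasureTheory.Measure.volume_eq_prod] at hG' ⊢
  rw [MeasureTheory.integral_prod_symm _ hG', ← MeasureTheory.integral_sub,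
    ← MeasureTheory.integral_indicator (hmeas _)]
  · refine MeasureTheory.integral_congr_ae (Filter.Eventually.of_forall fun y => ?_)
    simp only [hmp_apply]
    by_cases hy : y ∈ stdSimplexIn n
    · have hGy : (fun a : ℝ => G (i.insertNth a y)) = (Set.Icc 0 (1 - ∑ j, y j)).indicator
          fun a => fderiv ℝ F (i.insertNth a y : Fin (n + 1) → ℝ) (Pi.single i 1) := by
        funext a
        simp only [G, Set.indicator, insertNth_mem_stdSimplexIn_iff, hy, true_and]
      have h1 : (0 : ℝ) ≤ 1 - ∑ j, y j := by linarith [hy.2]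
      rw [hGy, MeasureTheory.integral_indicator measurableSet_Icc, Set.indicator_of_mem hy,
        MeasureTheory.integral_Icc_eq_integral_Ioc, ← intervalIntegral.integral_of_le h1]
      refine intervalIntegral.integral_eq_sub_of_hasDerivAt
        (f := fun a => F (i.insertNth a y : Fin (n + 1) → ℝ)) (fun a _ => ?_) ?_
      · have hd : HasDerivAt (fun a : ℝ => (i.insertNth a y : Fin (n + 1) → ℝ))
            (Pi.single i 1) a := by
          rw [hasDerivAt_pi, Fin.forall_iff_succAbove i]
          refine ⟨by simpa using hasDerivAt_id' a, fun j => ?_⟩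
          simpa [(Fin.succAbove_ne i j)] using hasDerivAt_const a (y j)
        exact ((hF.differentiable (by simp) _).hasFDerivAt).comp_hasDerivAt a hd
      · exact (hcont.comp (hins.comp (by fun_prop : Continuous fun a : ℝ => (a, y)))
          ).intervalIntegrable _ _
    · have hGy : (fun a : ℝ => G (i.insertNth a y)) = fun _ => 0 := by
        funext a
        simp only [G, Set.indicator, insertNth_mem_stdSimplexIn_iff, hy, false_and, if_false]
      rw [hGy, Set.indicator_of_notMem hy, MeasureTheory.integral_zero]
  · exact (hF.continuous.comp (hins.comp (by fun_prop :
      Continuous fun y : Fin n → ℝ => (1 - ∑ j, y j, y)))).continuousOn.integrableOn_compact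
      (isCompact_stdSimplexIn _)
  · exact (hF.continuous.comp (hins.comp (by fun_prop :
      Continuous fun y : Fin n → ℝ => ((0 : ℝ), y)))).continuousOn.integrableOn_compact
      (isCompact_stdSimplexIn _)

/-- Vertex `0` is the origin, so the face opposite vertex `i + 1` lies in the hyperplane where
coordinate `i` vanishes. -/
theorem vertexMapFun_succAbove_succ {n : ℕ} (i : Fin (n + 1)) (y : Fin n → ℝ) :
    vertexMapFun i.succ.succAbove y = (i.insertNth 0 y : Fin (n + 1) → ℝ) := by
  funext l
  simp only [vertexMapFun, Fin.sum_univ_succ, Fin.succ_succAbove_zero, Fin.succ_succAbove_succ,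
    (Fin.succ_ne_zero l).symm, if_false, zero_add, Fin.succ_inj, bary, Fin.cons_succ]
  rcases Fin.eq_self_or_eq_succAbove i l with rfl | ⟨j, rfl⟩
  · simp [Fin.succAbove_ne]
  · simp

theorem vertexMapFun_succ {n : ℕ} (y : Fin n → ℝ) :
    vertexMapFun (Fin.succAbove 0) y = (Fin.cons (1 - ∑ j, y j) y : Fin (n + 1) → ℝ) := by
  funext l
  simp [vertexMapFun, bary]

/-- Seen as a graph over the `i`-th coordinate hyperplane, the slanted face has a parametrization
depending on `i`. It differs from the standard one by a cyclic permutation of vertices, which does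
not affect integrals; hence the upper endpoints for all `i` contribute integrals over one and the
same face. -/
theorem vertexMapFun_succ_perm {n : ℕ} (i : Fin (n + 1)) (y : Fin n → ℝ) :
    vertexMapFun (Fin.succAbove 0) (vertexMapFun (i.cycleRange.symm) y) =
      (i.insertNth (1 - ∑ j, y j) y : Fin (n + 1) → ℝ) := by
  rw [vertexMapFun_comp]
  funext l
  simp only [vertexMapFun, Fin.succAbove_zero, Function.comp_apply, Fin.succ_inj,
    Fin.sum_univ_succ, bary, Fin.cons_zero, Fin.cons_succ, Fin.cycleRange_symm_zero,
    Fin.cycleRange_symm_succ]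
  rcases Fin.eq_self_or_eq_succAbove i l with rfl | ⟨j, rfl⟩
  · simp [Fin.succAbove_ne]
  · simp [(Fin.succAbove_ne i j).symm]

/-- The arguments are changed one slot at a time; each error term contains `v 0` twice and vanishes.
-/
theorem alternating_map_sub_zero {E : Type*} [AddCommGroup E] [Module ℝ E] {n : ℕ}
    (g : E [⋀^Fin (n + 1)]→ₗ[ℝ] ℝ) (v : Fin (n + 1) → E) :
    g (Fin.cons (v 0) fun j => v j.succ - v 0) = g v := by
  -- Here `s` is the set of slots already changed.
  have h : ∀ s : Finset (Fin (n + 1)), 0 ∉ s →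
      g (fun j => if j ∈ s then v j - v 0 else v j) = g v := by
    intro s
    induction s using Finset.induction_on with
    | empty => simp
    | insert a s has ih =>
      intro h0
      rw [Finset.mem_insert, not_or] at h0
      let w : Fin (n + 1) → E := fun j => if j ∈ s then v j - v 0 else v j
      have hw : (fun j => if j ∈ insert a s then v j - v 0 else v j) =
          Function.update w a (v a - v 0) := by
        funext j
        rcases eq_or_ne j a with rfl | hj
        · simp
        · simp [w, hj]
      have hwa : Function.update w a (v a) = w := by
        rw [Function.update_eq_self_iff]
        simp [w, has]
      have hw0 : w 0 = v 0 := by simp [w, h0.2]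
      rw [hw, g.map_update_sub, hwa, ← hw0, g.map_update_self w (Ne.symm h0.1), sub_zero]
      exact ih h0.2
  rw [← h (Finset.univ.erase 0) (by simp)]
  congr 1
  funext j
  refine Fin.cases ?_ (fun j => ?_) j <;> simp

/-- Both sides are values of the wedge product of `l` and `η`. On `v` it expands into the
alternating sum because `l` is `1` on every argument; after subtracting `v 0` from the others, `l`
kills the differences and only the leading term remains. -/
theorem alternating_sum_removeNth {n m : ℕ} (η : (Fin m → ℝ) [⋀^Fin n]→L[ℝ] ℝ)
    (v : Fin (n + 1) → Fin m → ℝ) (l : (Fin m → ℝ) →L[ℝ] ℝ) (hl : ∀ j, l (v j) = 1) :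
    η (fun j => v j.succ - v 0) = ∑ i : Fin (n + 1), (-1 : ℤ) ^ (i : ℕ) • η (i.removeNth v) := by
  let g := ContinuousAlternatingMap.alternatizeUncurryFin (l.smulRight η)
  have h := alternating_map_sub_zero g.toAlternatingMap v
  change g _ = g _ at h
  simp only [g, ContinuousAlternatingMap.alternatizeUncurryFin_apply,
    ContinuousLinearMap.smulRight_apply, hl, one_smul] at h
  rw [← h, Fin.sum_univ_succ, Finset.sum_eq_zero]
  · simp [hl]
  · intro i _
    simp [hl]

theorem integral_fun_zsmul {E : Type*} [MeasurableSpace E] {μ : MeasureTheory.Measure E} (a : ℤ)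
    (f : E → ℝ) : ∫ x, a • f x ∂μ = a • ∫ x, f x ∂μ := by
  simp only [zsmul_eq_mul, MeasureTheory.integral_const_mul]

theorem integrable_fun_zsmul {E : Type*} [MeasurableSpace E] {μ : MeasureTheory.Measure E} (a : ℤ)
    {f : E → ℝ} (hf : MeasureTheory.Integrable f μ) :
    MeasureTheory.Integrable (fun x => a • f x) μ := by
  simpa only [zsmul_eq_mul] using hf.const_mul (a : ℝ)

/-- Stokes' theorem on the standard simplex. -/
theorem setIntegral_extDeriv_stdSimplexIn {n : ℕ}
    {η : (Fin (n + 1) → ℝ) → (Fin (n + 1) → ℝ) [⋀^Fin n]→L[ℝ] ℝ} (hη : ContDiff ℝ ∞ η) :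
    ∫ x in stdSimplexIn (n + 1), extDeriv η x (fun i => Pi.single i 1) =
      ∑ i : Fin (n + 2), (-1 : ℤ) ^ (i : ℕ) • ∫ y in stdSimplexIn n,
        (η (vertexMapFun i.succAbove y)).compContinuousLinearMap
          (fderiv ℝ (vertexMapFun i.succAbove) y) (fun i => Pi.single i 1) := by
  let b : Fin (n + 1) → Fin (n + 1) → ℝ := fun i => Pi.single i 1
  -- `F i` is the coefficient of `η` on all coordinate directions except the `i`-th, so `dη` on the
  -- standard basis is the alternating sum of the partial derivatives `∂_i F_i`.
  let F : Fin (n + 1) → (Fin (n + 1) → ℝ) → ℝ := fun i x => η x (i.removeNth b)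
  let ev : ∀ v : Fin n → Fin (n + 1) → ℝ, ((Fin (n + 1) → ℝ) [⋀^Fin n]→L[ℝ] ℝ) →L[ℝ] ℝ :=
    fun v => ContinuousAlternatingMap.apply ℝ _ _ v
  have hF : ∀ i, ContDiff ℝ ∞ (F i) := fun i => (ev (i.removeNth b)).contDiff.comp hη
  have hFd : ∀ i x v, fderiv ℝ (F i) x v = fderiv ℝ η x v (i.removeNth b) := by
    intro i x v
    have := ((ev (i.removeNth b)).hasFDerivAt.comp x
      (hη.differentiable (by simp) x).hasFDerivAt).fderiv
    exact DFunLike.congr_fun this v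
  have hint : ∀ {m : ℕ} {f : (Fin m → ℝ) → ℝ}, Continuous f →
      MeasureTheory.IntegrableOn f (stdSimplexIn m) := fun hf =>
    hf.continuousOn.integrableOn_compact (isCompact_stdSimplexIn _)
  have hvc : ∀ {m k : ℕ} (θ : Fin (m + 1) → Fin (k + 1)), Continuous (vertexMapFun θ) :=
    fun θ => (vertexMap θ).smooth.continuous
  have hL : ∫ x in stdSimplexIn (n + 1), extDeriv η x b =
      ∑ i : Fin (n + 1), (-1 : ℤ) ^ (i : ℕ) •
        ((∫ y in stdSimplexIn n, F i (vertexMapFun (Fin.succAbove 0) y)) -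
          ∫ y in stdSimplexIn n, F i (vertexMapFun i.succ.succAbove y)) := by
    have h1 : ∀ x, extDeriv η x b =
        ∑ i : Fin (n + 1), (-1 : ℤ) ^ (i : ℕ) • fderiv ℝ (F i) x (Pi.single i 1) := fun x => by
      simp only [extDeriv, ContinuousAlternatingMap.alternatizeUncurryFin_apply, hFd, b]
    simp only [h1]
    rw [MeasureTheory.integral_finsetSum]
    · refine Finset.sum_congr rfl fun i _ => ?_
      rw [integral_fun_zsmul, setIntegral_partial_stdSimplexIn i (hF i)]
      simp only [← vertexMapFun_succ_perm, vertexMapFun_succAbove_succ]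
      rw [setIntegral_vertexMapFun_perm i.cycleRange.symm
        fun y => F i (vertexMapFun (Fin.succAbove 0) y)]
    · intro i _
      exact integrable_fun_zsmul _
        (hint (((hF i).continuous_fderiv (by simp)).clm_apply continuous_const))
  -- On a coordinate face the tangent basis is the standard basis with the `i`-th vector removed, so
  -- a single coefficient survives.
  have hsucc : ∀ (i : Fin (n + 1)) y, (η (vertexMapFun i.succ.succAbove y)).compContinuousLinearMap
      (fderiv ℝ (vertexMapFun i.succ.succAbove) y) (fun i => Pi.single i 1) =
      F i (vertexMapFun i.succ.succAbove y) := by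
    intro i y
    simp only [ContinuousAlternatingMap.compContinuousLinearMap_apply, F]
    congr 1
    funext j
    simp only [Function.comp_apply, fderiv_vertexMapFun]
    rw [vertexMapFun_succAbove_succ, vertexMapFun_succAbove_succ]
    funext l
    rcases Fin.eq_self_or_eq_succAbove i l with rfl | ⟨l, rfl⟩
    · simp [b, Fin.removeNth]
    · simp [b, Fin.removeNth, Pi.single_apply]
  -- On the slanted face the tangent basis is `b j.succ - b 0`. The sum of the coordinates equals
  -- `1` on every `b j`, so the wedge identity produces all the coefficients at once.
  have hzero : ∀ y, (η (vertexMapFun (Fin.succAbove 0) y)).compContinuousLinearMap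
      (fderiv ℝ (vertexMapFun (Fin.succAbove 0)) y) (fun i => Pi.single i 1) =
      ∑ i : Fin (n + 1), (-1 : ℤ) ^ (i : ℕ) • F i (vertexMapFun (Fin.succAbove 0) y) := by
    intro y
    have h := alternating_sum_removeNth (η (vertexMapFun (Fin.succAbove 0) y)) b
      (∑ i, ContinuousLinearMap.proj i) (fun j => by simp [b])
    rw [← h]
    simp only [ContinuousAlternatingMap.compContinuousLinearMap_apply]
    congr 1
    funext j
    simp only [Function.comp_apply, fderiv_vertexMapFun]
    rw [vertexMapFun_succ, vertexMapFun_succ]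
    funext l
    refine Fin.cases ?_ (fun l => ?_) l
    · simp [b]
    · simp [b, Pi.single_apply]
  -- The face opposite vertex `i + 1` carries the sign `(-1)^(i+1)`, matching the minus sign of the
  -- lower endpoint in `hL`.
  rw [Fin.sum_univ_succ]
  simp only [hsucc, hzero]
  refine hL.trans ?_
  rw [MeasureTheory.integral_finsetSum]
  · simp only [integral_fun_zsmul, smul_sub, Finset.sum_sub_distrib, Fin.val_zero,
      pow_zero, one_smul, Fin.val_succ, pow_succ, mul_neg, mul_one, neg_smul,
      Finset.sum_neg_distrib, ← sub_eq_add_neg]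
  · intro i _
    exact integrable_fun_zsmul _ (hint ((hF i).continuous.comp (hvc _)))

/-- Any differentiable extension computes the derivative, since derivatives within the simplex are
unique even at boundary points. -/
theorem extD_apply {X : Type u} [DifferentialSpace X] {k n : ℕ} (α : Form X k) (σ : SSimplex X n)
    {η : (Fin n → ℝ) → (Fin n → ℝ) [⋀^Fin k]→L[ℝ] ℝ} (hη : Differentiable ℝ η)
    (h : ∀ x ∈ stdSimplexIn n, α.1 n σ x = η x) {x : Fin n → ℝ} (hx : x ∈ stdSimplexIn n) :
    (extD α).1 n σ x = extDeriv η x := by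
  refine (Set.indicator_of_mem hx _).trans ?_
  rw [extDerivWithin_congr' h hx, extDerivWithin, extDeriv,
    (hη x).fderivWithin (uniqueDiffOn_stdSimplexIn n x hx)]

theorem integral_boundary_single {X : Type u} [DifferentialSpace X] {k : ℕ} (α : Form X k)
    (σ : SSimplex X (k + 1)) :
    Form.integral α ((singular X).d k (Finsupp.single σ 1 : Chain X (k + 1))) =
      ∑ i : Fin (k + 2), (-1 : ℤ) ^ (i : ℕ) • Form.integralSimplex α (σ.face i) := by
  have hΦ : ∀ Φ : Chain X k →+ ℝ, Φ (boundary X k (Finsupp.single σ 1)) =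
      ∑ i : Fin (k + 2), (-1 : ℤ) ^ (i : ℕ) • Φ (Finsupp.single (σ.face i) 1) := fun Φ => by
    rw [boundary_single, map_sum]
    exact Finset.sum_congr rfl fun i _ => map_zsmul _ _ _
  refine (hΦ (Form.integral α)).trans (Finset.sum_congr rfl fun i _ => congrArg _ ?_)
  exact (Form.integral_single α (σ.face i) 1).trans (by simp)

/-- Stokes' theorem for smooth singular chains. -/
theorem integral_extD {X : Type u} [DifferentialSpace X] {k : ℕ} (α : Form X k)
    (c : (singular X).C (k + 1)) :
    Form.integral (extD α) c = Form.integral α ((singular X).d k c) := by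
  suffices h : Form.integral (extD α) = (Form.integral α).comp ((singular X).d k) from
    DFunLike.congr_fun h c
  refine Finsupp.addHom_ext' fun σ => AddMonoidHom.ext_int ?_
  refine Eq.trans ?_ (integral_boundary_single α σ).symm
  refine (Form.integral_single (extD α) σ 1).trans ?_
  obtain ⟨η, hη, h⟩ := α.2.1 _ σ
  have hmeas := fun n => (isCompact_stdSimplexIn n).measurableSet
  rw [Int.cast_one, one_mul, Form.integralSimplex, MeasureTheory.setIntegral_congr_fun (hmeas _)
    fun x hx => DFunLike.congr_fun (extD_apply α σ (hη.differentiable (by simp)) h hx) _,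
    setIntegral_extDeriv_stdSimplexIn hη]
  refine Finset.sum_congr rfl fun i _ => congrArg _ ?_
  refine MeasureTheory.setIntegral_congr_fun (hmeas _) fun x hx => ?_
  have h1 := α.2.2.2.1 _ _ σ (vertexMap i.succAbove) x hx
  rw [h _ ((vertexMap i.succAbove).mapsTo hx)] at h1
  exact (DFunLike.congr_fun h1 _).symm

/-! ### Forms are determined by their integrals; closedness of curvature -/

/-- A form on a differential space is determined by its integrals over smooth simplices. -/
theorem Form.eq_zero_of_integralSimplex {X : Type u} [DifferentialSpace X] {k : ℕ} {α : Form X k}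
    (hα : ∀ σ : SSimplex X k, Form.integralSimplex α σ = 0) : α = 0 := by
  refine Subtype.ext (funext fun n => funext fun σ => funext fun x => ?_)
  change α.1 n σ x = 0
  by_cases hx : x ∈ stdSimplexIn n
  swap
  · exact α.2.2.1 n σ x hx
  obtain ⟨η, hη, h⟩ := α.2.1 n σ
  have hint : ∀ p ∈ interior (stdSimplexIn n), η p = 0 := by
    intro p hp
    ext v
    let L : (Fin k → ℝ) →L[ℝ] (Fin n → ℝ) :=
      ∑ i, (ContinuousLinearMap.proj (R := ℝ) (φ := fun _ : Fin k => ℝ) i).smulRight (v i)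
    have hL : ∀ i, L (Pi.single i 1) = v i := fun i => by
      simp [L, Pi.single_apply]
    -- The simplex `y ↦ p + t • L y` shrinks to `p` and has edge vectors `t • v i`. Its integral is
    -- `t ^ k * J t`, so `J` vanishes for small positive `t`; by continuity so does `J 0`, which is
    -- `η p v` times the volume of the simplex.
    let J : ℝ → ℝ := fun t => ∫ y in stdSimplexIn k, η (p + t • L y) v
    have hJ : Continuous J := by
      refine continuous_parametric_integral_of_continuous ?_ (isCompact_stdSimplexIn _)
      exact (ContinuousAlternatingMap.apply ℝ _ _ v).continuous.comp
        (hη.continuous.comp (by fun_prop))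
    obtain ⟨M, hM⟩ := (isCompact_stdSimplexIn k).exists_bound_of_continuousOn
      L.continuous.continuousOn
    obtain ⟨δ, hδ, hball⟩ := Metric.isOpen_iff.1 isOpen_interior p hp
    have hM0 : 0 ≤ M := (norm_nonneg _).trans (hM 0 (zero_mem_stdSimplexIn k))
    -- `M` bounds `L` on the simplex, so for these `t` the small simplex stays in the ball of radius
    -- `δ` about `p`. Using `M + 1` keeps the denominator positive.
    have hJ0 : ∀ t ∈ Set.Ioo 0 (δ / (M + 1)), J t = 0 := by
      intro t ht
      have htM : t * (M + 1) < δ := (lt_div_iff₀ (by positivity)).1 ht.2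
      let g : SimplexMap k n :=
        { toFun := fun y => p + t • L y
          smooth := by fun_prop
          mapsTo := fun y hy => interior_subset (hball (by
            rw [Metric.mem_ball, dist_eq_norm, add_sub_cancel_left, norm_smul,
              Real.norm_of_nonneg ht.1.le]
            nlinarith [mul_le_mul_of_nonneg_left (hM y hy) ht.1.le, ht.1])) }
      have hg : ∀ y, fderiv ℝ g.toFun y = t • L := fun y =>
        ((L.hasFDerivAt.const_smul t).const_add p).fderiv
      have h1 := hα (σ.comp g)
      rw [Form.integralSimplex, MeasureTheory.setIntegral_congr_fun
        (g := fun y => t ^ k * η (p + t • L y) v) (isCompact_stdSimplexIn k).measurableSet,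
        MeasureTheory.integral_const_mul] at h1
      · exact (mul_eq_zero.1 h1).resolve_left (pow_ne_zero _ ht.1.ne')
      · intro y hy
        simp only [α.2.2.2.1 _ _ σ g y hy, hg, h _ (g.mapsTo hy)]
        rw [ContinuousAlternatingMap.compContinuousLinearMap_apply]
        have : (⇑(t • L) ∘ fun i : Fin k => Pi.single i (1 : ℝ)) = fun i => t • v i := by
          funext i
          simp [hL]
        rw [this]
        refine ((η _).map_smul_univ (fun _ => t) v).trans ?_
        simp [g]
    have hlim : J 0 = 0 := by
      refine tendsto_nhds_unique (l := 𝓝[>] (0 : ℝ))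
        (hJ.continuousAt.tendsto.mono_left nhdsWithin_le_nhds) ?_
      refine (tendsto_const_nhds (x := (0 : ℝ))).congr' ?_
      filter_upwards [Ioo_mem_nhdsGT (show 0 < δ / (M + 1) by positivity)] with t ht
      exact (hJ0 t ht).symm
    simp only [J, zero_smul, add_zero, MeasureTheory.setIntegral_const, smul_eq_mul] at hlim
    exact (mul_eq_zero.1 hlim).resolve_left (volume_real_stdSimplexIn_pos k).ne'
  -- Boundary points are reached by continuity, as the interior is dense in the simplex.
  have hcl : x ∈ closure (interior (stdSimplexIn n)) := by
    rw [(convex_stdSimplexIn n).closure_interior_eq_closure_of_nonempty_interior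
      (interior_stdSimplexIn_nonempty n)]
    exact subset_closure hx
  rw [h x hx]
  exact closure_minimal hint (isClosed_eq hη.continuous continuous_const) hcl

theorem Form.eq_zero_of_integral {X : Type u} [DifferentialSpace X] {k : ℕ} {α : Form X k}
    (hα : Form.integral α = 0) : α = 0 :=
  Form.eq_zero_of_integralSimplex fun σ => by
    have h1 : Form.integral α (Finsupp.single σ 1 : Chain X k) = 0 := by rw [hα]; rfl
    rw [Form.integral_single, Int.cast_one, one_mul] at h1
    exact h1

/-- The curvature of a differential character is closed. -/
theorem HasCurvature.extD_eq_zero {X : Type u} [DifferentialSpace X] {n : ℕ}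
    {h : (singular X).cycles n →+ Additive Circle} {α : Form X (n + 1)} (hα : HasCurvature h α) :
    extD α = 0 := by
  -- Since `∂∂ = 0`, the integral of `α` over any boundary is an integer; shrinking simplices makes
  -- it zero. By Stokes all integrals of `dα` vanish.
  refine Form.eq_zero_of_integral (AddMonoidHom.ext fun c => ?_)
  rw [integral_extD]
  refine integral_d_eq_zero_of_int α (fun b => ?_) c
  have hbd : (singular X).bd n ((singular X).d (n + 1) b) = 0 :=
    Subtype.ext ((singular X).d_d n b)
  rw [← hα, hbd, map_zero]

/-- Definitional: the derivative is taken simplex by simplex, and pull-back only changes which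
simplex is looked up. -/
theorem extD_pullback {X : Type u} [DifferentialSpace X] {A : Type v} [DifferentialSpace A]
    (φ : SmoothMap A X) {k : ℕ} (α : Form X k) :
    extD (Form.pullback φ α) = Form.pullback φ (extD α) := rfl

/-! ### Characters and lifts -/

/-- Pass to the quotient by the kernel of `f`, which embeds in `N`, and use divisibility of `U(1)`.
-/
theorem exists_extension_of_ker_le {M : Type u} {N : Type v} [AddCommGroup M] [AddCommGroup N]
    (f : M →+ N) (g : M →+ Additive Circle) (h : ∀ x, f x = 0 → g x = 0) :
    ∃ g' : N →+ Additive Circle, ∀ x, g' (f x) = g x := by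
  obtain ⟨g', hg'⟩ := exists_extension (QuotientAddGroup.kerLift f)
    (QuotientAddGroup.kerLift_injective f) (QuotientAddGroup.lift f.ker g h)
  exact ⟨g', fun x => hg' (QuotientAddGroup.mk x)⟩

theorem exists_int_hom {M : Type u} [AddCommGroup M] (F : M →+ ℝ) (h : ∀ c, e (F c) = 0) :
    ∃ m : M →+ ℤ, ∀ c, (m c : ℝ) = F c := by
  choose m hm using fun c => (e_eq_zero_iff _).1 (h c)
  refine ⟨AddMonoidHom.mk' m fun a b => ?_, fun c => (hm c).symm⟩
  have := hm (a + b)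
  rw [map_add, hm, hm] at this
  exact_mod_cast this.symm

namespace AbComplex

/-- With the zero group in degree `-1`, coboundaries have one description in all degrees, so later
arguments need no separate treatment of degree `0`. -/
theorem mem_coboundaries_iff {G : Type w} [AddCommGroup G] (K : AbComplex.{u}) (n : ℕ)
    (μ : K.C n →+ G) :
    μ ∈ K.coboundaries G n ↔ ∃ ν : K.shiftC n →+ G, μ = ν.comp (K.shiftD n) := by
  cases n with
  | zero => exact ⟨fun h => ⟨0, h⟩, fun ⟨ν, hν⟩ =>
    AddSubgroup.mem_bot.2 (hν.trans (AddMonoidHom.comp_zero ν))⟩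
  | succ n => exact ⟨fun ⟨ν, hν⟩ => ⟨ν, hν.symm⟩, fun ⟨ν, hν⟩ => ⟨ν, hν.symm⟩⟩

theorem shiftD_d (K : AbComplex.{u}) (n : ℕ) (c : K.C (n + 1)) : K.shiftD n (K.d n c) = 0 := by
  cases n with
  | zero => rfl
  | succ n => exact K.d_d n c

theorem shiftD_cycle (K : AbComplex.{u}) (n : ℕ) (c : K.cycles n) : K.shiftD n c = 0 := by
  cases n with
  | zero => rfl
  | succ n => exact c.2

end AbComplex

/-! ### The maps of the exact sequence -/

theorem charClass_eq_mk {X : Type u} [DifferentialSpace X] {n : ℕ} {h : diffChar X n}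
    {μ : (singular X).cocycles ℤ (n + 1)} (hμ : IsCharCocycle h μ) :
    charClass X n h = QuotientAddGroup.mk μ :=
  (Classical.choose_spec (exists_isCharCocycle h)).unique hμ

/-- This allows the curvature form and the real lift to be prescribed. The cochain is integral
because `e` annihilates it, and it is a cocycle because curvature is closed. -/
theorem exists_isCharCocycle_of_lift {X : Type u} [DifferentialSpace X] {n : ℕ} (h : diffChar X n)
    {α : Form X (n + 1)} (hα : HasCurvature h.1 α) (T : (singular X).cycles n →+ ℝ)
    (hT : ∀ z, e (T z) = h.1 z) : ∃ μ : (singular X).cocycles ℤ (n + 1),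
      IsCharCocycle h μ ∧ ∀ c, (μ.1 c : ℝ) = Form.integral α c - T ((singular X).bd n c) := by
  obtain ⟨μ, hμ⟩ := exists_int_hom (Form.integral α - T.comp ((singular X).bd n)) fun c => by
    change e (Form.integral α c - T ((singular X).bd n c)) = 0
    rw [map_sub, hT, hα, sub_self]
  have hμ' : ∀ c, (μ c : ℝ) = Form.integral α c - T ((singular X).bd n c) := hμ
  refine ⟨⟨μ, AddMonoidHom.ext fun b => ?_⟩, ⟨α, T, hα, hT, hμ'⟩, hμ'⟩
  change μ ((singular X).d (n + 1) b) = 0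
  have hbd : (singular X).bd n ((singular X).d (n + 1) b) = 0 :=
    Subtype.ext ((singular X).d_d n b)
  have h1 := hμ' ((singular X).d (n + 1) b)
  rw [← integral_extD, hα.extD_eq_zero, hbd, map_zero, map_zero, AddMonoidHom.zero_apply,
    sub_zero] at h1
  exact_mod_cast h1

/-- A form `α` represents the real class of `μ`, with `∫ α - μ = T ∘ ∂`. Modulo integers `T ∘ ∂` is
`∫ α`, so `e ∘ T` on cycles is a character of curvature `α`, and with the lift `T` its cocycle is
`μ` itself. -/
theorem charClass_surjective {X : Type u} [DifferentialSpace X] (hX : DeRhamTheorem X) (n : ℕ) :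
    Function.Surjective (charClass X n) := by
  intro q
  obtain ⟨μ, rfl⟩ := QuotientAddGroup.mk_surjective q
  have hμ : ∀ c, μ.1 ((singular X).d (n + 1) c) = 0 := DFunLike.congr_fun μ.2
  obtain ⟨α, -, T, hT⟩ := hX.surjective (n + 1) ((Int.castAddHom ℝ).comp μ.1)
    (AddMonoidHom.ext fun c => by
      change ((μ.1 ((singular X).d (n + 1) c) : ℤ) : ℝ) = 0
      rw [hμ, Int.cast_zero])
  have hT : ∀ c, T ((singular X).d n c) = Form.integral α c - μ.1 c := DFunLike.congr_fun hT
  have hcurv : HasCurvature ((e.comp T).comp ((singular X).cycles n).subtype) α := fun c => by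
    change e (T ((singular X).d n c)) = _
    rw [hT, map_sub, (e_eq_zero_iff (μ.1 c : ℝ)).2 ⟨_, rfl⟩, sub_zero]
  refine ⟨⟨_, α, hcurv⟩, charClass_eq_mk
    ⟨α, T.comp ((singular X).cycles n).subtype, hcurv, fun _ => rfl, fun c => ?_⟩⟩
  change _ = Form.integral α c - T ((singular X).d n c)
  rw [hT]
  ring

theorem DiffH.c_surjective {X : Type u} [DifferentialSpace X] (hX : DeRhamTheorem X) :
    ∀ k, Function.Surjective (DiffH.c X k)
  | 0 => Function.surjective_id
  | n + 1 => charClass_surjective hX n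

variable {X : Type u} [DifferentialSpace X] {A : Type v} [DifferentialSpace A]

theorem pullbackC_surjective (hX : DeRhamTheorem X) (φ : SmoothMap A X) (k : ℕ) :
    Function.Surjective (pullbackC φ k) :=
  (pullbackH φ k).rangeRestrict_surjective.comp (DiffH.c_surjective hX k)

theorem pullbackC_eq_zero_iff (φ : SmoothMap A X) (k : ℕ) (h : DiffH X k) :
    pullbackC φ k h = 0 ↔ pullbackH φ k (DiffH.c X k h) = 0 :=
  Subtype.ext_iff

theorem pullbackH_mk_eq_zero_iff (φ : SmoothMap A X) (k : ℕ) (μ : (singular X).cocycles ℤ k) :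
    pullbackH φ k (QuotientAddGroup.mk μ) = 0 ↔
      μ.1.comp ((pushforward φ).f k) ∈ (singular A).coboundaries ℤ k :=
  QuotientAddGroup.eq_zero_iff ((pushforward φ).cocyclesMap ℤ k μ)

/-! ### Exactness at the characters on `A` and at the relative characters -/

/-- A cycle `t` of `A` is the second component of a cone cycle exactly when `φ_* t` bounds. Thus the
kernel condition says that `g` factors through the image of the cycles of `A` in the cycles of `X`
modulo boundaries, and homomorphisms on that quotient are the flat characters. -/
theorem charI_eq_zero_iff (φ : SmoothMap A X) (n : ℕ) (g : diffChar A n) :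
    charI φ n g = 0 ↔ g ∈ (flatChar X n).map (pullbackChar φ n) := by
  have hI : charI φ n g = 0 ↔
      ∀ z : (relSingular φ).cycles (n + 1), g.1 (AbComplex.coneProj (pushforward φ) n z) = 0 :=
    Subtype.ext_iff.trans DFunLike.ext_iff
  rw [hI]
  constructor
  · intro h
    obtain ⟨f, hf⟩ := exists_extension_of_ker_le
      ((QuotientAddGroup.mk' ((singular X).bd n).range).comp ((pushforward φ).cyclesMap n)) g.1
      (by
        intro t ht
        obtain ⟨s, hs⟩ := (QuotientAddGroup.eq_zero_iff _).1 ht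
        have hs' : (singular X).d n s = (pushforward φ).f n t := congrArg Subtype.val hs
        -- From `∂s = φ_* t` it follows that `(-s, t)` is a cone cycle.
        refine h ⟨(-s, t.1), Prod.ext ?_ ?_⟩
        · change (singular X).d n (-s) + (pushforward φ).f n t = 0
          rw [map_neg, hs', neg_add_cancel]
        · change -(singular A).shiftD n t = 0
          rw [AbComplex.shiftD_cycle, neg_zero])
    have hflat : HasCurvature (f.comp (QuotientAddGroup.mk' ((singular X).bd n).range))
        (0 : Form X (n + 1)) := fun c => by
      have h0 : (QuotientAddGroup.mk ((singular X).bd n c) :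
          (singular X).cycles n ⧸ ((singular X).bd n).range) = 0 :=
        (QuotientAddGroup.eq_zero_iff _).2 ⟨c, rfl⟩
      change f (QuotientAddGroup.mk _) = _
      rw [h0, map_zero, map_zero, AddMonoidHom.zero_apply, map_zero]
    exact ⟨⟨_, 0, hflat⟩, hflat, Subtype.ext (AddMonoidHom.ext hf)⟩
  · rintro ⟨f, hf, rfl⟩ z
    have hf : HasCurvature f.1 0 := hf
    obtain ⟨⟨s, t⟩, hz⟩ := z
    have h1 : (singular X).d n s + (pushforward φ).f n t = 0 := congrArg Prod.fst hz
    have h2 : (pushforward φ).cyclesMap n (AbComplex.coneProj (pushforward φ) n ⟨(s, t), hz⟩) =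
        (singular X).bd n (-s) := by
      refine Subtype.ext ?_
      change (pushforward φ).f n t = (singular X).d n (-s)
      rw [map_neg, eq_neg_of_add_eq_zero_right h1]
    change f.1 ((pushforward φ).cyclesMap n _) = 0
    rw [h2, hf, map_zero, AddMonoidHom.zero_apply, map_zero]

theorem charP_eq_zero_iff (φ : SmoothMap A X) (n : ℕ) (f : relDiffChar φ n) :
    charP φ n f = 0 ↔ ∀ z : (singular X).cycles n,
      f.1 ((AbComplex.coneIncl (pushforward φ)).cyclesMap n z) = 0 :=
  Subtype.ext_iff.trans DFunLike.ext_iff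

/-- The kernel of `coneProj` consists of the pairs `(z, 0)` with `z` a cycle of `X`, which are
precisely the cycles tested by `charP`. -/
theorem exact_charI_charP (φ : SmoothMap A X) (n : ℕ) :
    Function.Exact (charI φ n) (charP φ (n + 1)) := by
  intro f
  rw [charP_eq_zero_iff]
  constructor
  · intro h
    obtain ⟨g, hg⟩ := exists_extension_of_ker_le (AbComplex.coneProj (pushforward φ) n) f.1 (by
      rintro ⟨⟨s, t⟩, hz⟩ ht
      obtain rfl : t = 0 := congrArg Subtype.val ht
      have h1 : (singular X).d n s + (pushforward φ).f n 0 = 0 := congrArg Prod.fst hz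
      rw [map_zero, add_zero] at h1
      exact h ⟨s, h1⟩)
    obtain ⟨α, β, hf⟩ := f.2
    -- The cone differential has `-∂` in its second component, hence the curvature of `g` is minus
    -- the covariant derivative of `f`.
    refine ⟨⟨g, -β, fun c => ?_⟩, Subtype.ext (AddMonoidHom.ext hg)⟩
    have h1 := hf 0 c
    have h2 : AbComplex.coneProj (pushforward φ) n ((relSingular φ).bd (n + 1) (0, c)) =
      -(singular A).bd n c := Subtype.ext rfl
    rw [← hg, h2, map_neg, map_zero, zero_add] at h1
    rw [Form.integral_neg, AddMonoidHom.neg_apply, map_neg, ← h1, neg_neg]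
  · rintro ⟨g, rfl⟩ z
    change g.1 (AbComplex.coneProj (pushforward φ) n _) = 0
    have h2 : AbComplex.coneProj (pushforward φ) n
      ((AbComplex.coneIncl (pushforward φ)).cyclesMap (n + 1) z) = 0 := Subtype.ext rfl
    rw [h2, map_zero]

/-- The degree-zero part of the cone has no contribution from `A`, so every relative cycle has the
form `(s, 0)`. -/
theorem charP_zero_injective (φ : SmoothMap A X) : Function.Injective (charP φ 0) := by
  rw [injective_iff_map_eq_zero]
  intro f hf
  rw [charP_eq_zero_iff] at hf
  refine Subtype.ext (AddMonoidHom.ext ?_)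
  rintro ⟨⟨s, t⟩, hz⟩
  exact hf ⟨s, AddSubgroup.mem_top _⟩

/-! ### Exactness at the characters on `X` -/

/-- Homomorphisms from a group of relative cycles to `U(1)` lift to real cochains. -/
theorem exists_rel_lift (φ : SmoothMap A X) (n : ℕ)
    (f : (relSingular φ).cycles n →+ Additive Circle) :
    ∃ (T : (singular X).C n →+ ℝ) (U : (singular A).shiftC n →+ ℝ),
      ∀ z : (relSingular φ).cycles n, e (T z.1.1 + U z.1.2) = f z := by
  obtain ⟨g, hg⟩ := exists_extension ((relSingular φ).cycles n).subtype Subtype.val_injective f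
  let g : (singular X).C n × (singular A).shiftC n →+ Additive Circle := g
  have hg : ∀ z : (relSingular φ).cycles n, g z.1 = f z := hg
  obtain ⟨T, hT⟩ := exists_lift_chain (g.comp (AddMonoidHom.inl _ _))
  have hU : ∀ (n : ℕ) (g' : (singular A).shiftC n →+ Additive Circle),
      ∃ U : (singular A).shiftC n →+ ℝ, ∀ c, e (U c) = g' c
    -- In degree `0` the shifted group is trivial, so the zero lift works.
    | 0, g' => ⟨0, fun c => (map_zero e).trans (map_zero g').symm⟩
    | n + 1, g' => exists_lift_chain g'
  obtain ⟨U, hU⟩ := hU n (g.comp (AddMonoidHom.inr _ _))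
  refine ⟨T, U, fun z => ?_⟩
  rw [map_add, hT, hU, ← hg]
  change g (z.1.1, 0) + g (0, z.1.2) = _
  rw [← map_add, Prod.mk_add_mk, add_zero, zero_add]
  rfl

/-- A real lift `(T, U)` of `f` represents `c(p(f))` by the cocycle `μ = ∫ α - T ∘ ∂`, and `f`
supplies an integral cochain `ν` on `A` with `φ^*μ = -δν`. -/
theorem pullbackH_charClass_charP (φ : SmoothMap A X) (n : ℕ) (f : relDiffChar φ n) :
    pullbackH φ (n + 1) (charClass X n (charP φ n f)) = 0 := by
  obtain ⟨α, β, hf⟩ := f.2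
  obtain ⟨T, U, hTU⟩ := exists_rel_lift φ n f.1
  have hcurv : HasCurvature (charP φ n f).1 α := fun c => by
    have h0 := hf c 0
    rw [map_zero, add_zero] at h0
    rw [← h0]
    exact congrArg f.1 (Subtype.ext ((AbComplex.coneIncl (pushforward φ)).comm n c))
  obtain ⟨μ, hμ, hμT⟩ := exists_isCharCocycle_of_lift (charP φ n f) hcurv
    (T.comp ((singular X).cycles n).subtype) fun z => by
      refine Eq.trans ?_ (hTU ((AbComplex.coneIncl (pushforward φ)).cyclesMap n z))
      change e (T z) = e (T z + U 0)
      rw [map_zero, add_zero]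
  have hμT : ∀ c, (μ.1 c : ℝ) = Form.integral α c - T ((singular X).d n c) := hμT
  rw [charClass_eq_mk hμ, pullbackH_mk_eq_zero_iff]
  -- `ν` compares the lift on `∂_φ(0, y)` with `∫_y β`; both exponentiate to the same value of `f`,
  -- so the difference is an integer.
  obtain ⟨ν, hν⟩ := exists_int_hom (T.comp ((pushforward φ).f n) -
    U.comp ((singular A).shiftD n) - Form.integral β) fun y => by
      have h1 := hTU ((relSingular φ).bd n (0, y))
      have h2 : T ((relSingular φ).bd n (0, y)).1.1 + U ((relSingular φ).bd n (0, y)).1.2 =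
          T ((pushforward φ).f n y) - U ((singular A).shiftD n y) := by
        change T ((singular X).d n 0 + (pushforward φ).f n y) +
          U (-(singular A).shiftD n y) = _
        rw [map_zero, zero_add, map_neg, sub_eq_add_neg]
      rw [h2, hf, map_zero, zero_add] at h1
      change e (T ((pushforward φ).f n y) - U ((singular A).shiftD n y) - Form.integral β y) = 0
      rw [map_sub, h1, sub_self]
  have hν : ∀ y, (ν y : ℝ) = T ((pushforward φ).f n y) - U ((singular A).shiftD n y) -
      Form.integral β y := hν
  have hsub : Form.integral (Form.pullback φ α - extD β) =
      Form.integral (Form.pullback φ α) - Form.integral (extD β) :=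
    map_sub (Form.integral (X := A) (n := n + 1)) _ _
  have hsum : ∀ y, ((μ.1 ((pushforward φ).f (n + 1) y) + ν ((singular A).d n y) : ℤ) : ℝ) =
      Form.integral (Form.pullback φ α - extD β) y := fun y => by
    push_cast
    rw [hμT, hν, (pushforward φ).comm, AbComplex.shiftD_d, map_zero, hsub,
      AddMonoidHom.sub_apply, Form.integral_pullback, integral_extD]
    ring
  -- `φ^*μ + δν` is integer-valued and is integration of `φ^*α - dβ`, so the shrinking argument
  -- makes it vanish.
  have hzero := integral_eq_zero_of_int (Form.pullback φ α - extD β) fun y =>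
    (e_eq_zero_iff _).2 ⟨_, (hsum y).symm⟩
  refine ⟨-ν, AddMonoidHom.ext fun y => ?_⟩
  change -ν ((singular A).d n y) = μ.1 ((pushforward φ).f (n + 1) y)
  have h1 := hsum y
  rw [hzero, AddMonoidHom.zero_apply] at h1
  exact neg_eq_of_add_eq_zero_left (by exact_mod_cast h1)

/-- By the de Rham theorem, a real cochain whose coboundary is given by a closed form agrees with
the integral of a form up to a coboundary. -/
theorem DeRhamTheorem.exists_form_of_coboundary (hA : DeRhamTheorem A) {n : ℕ}
    {α : Form A (n + 1)} (hα : extD α = 0) (R : (singular A).C n →+ ℝ)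
    (hR : ∀ c, R ((singular A).d n c) = Form.integral α c) :
    ∃ β : Form A n, Form.integral β - R ∈ (singular A).coboundaries ℝ n := by
  -- Injectivity gives a primitive `β` of `α`. Then `R - ∫ β` is a cocycle, represented up to a
  -- coboundary by a closed form `γ`, and `γ + β` is the required form.
  obtain ⟨β, rfl⟩ := hA.injective_succ n α hα ⟨R, AddMonoidHom.ext hR⟩
  obtain ⟨γ, -, hγ⟩ := hA.surjective n (R - Form.integral β) (AddMonoidHom.ext fun c => by
    change R ((singular A).d n c) - Form.integral β ((singular A).d n c) = 0
    rw [hR, integral_extD, sub_self])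
  refine ⟨γ + β, ?_⟩
  rw [map_add]
  convert hγ using 1
  abel

/-- The relative character is built from real cochains `S` on `X` and `U` on `A`; the trivialization
`ν` of `φ^*μ` lets the de Rham theorem on `A` provide both `U` and the covariant derivative `β`. -/
theorem exists_charP_eq (hA : DeRhamTheorem A) (φ : SmoothMap A X) (n : ℕ) (h : diffChar X n)
    (hh : pullbackH φ (n + 1) (charClass X n h) = 0) : ∃ f, charP φ n f = h := by
  obtain ⟨μ, hμ⟩ := exists_isCharCocycle h
  rw [charClass_eq_mk hμ, pullbackH_mk_eq_zero_iff] at hh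
  obtain ⟨α, T, hα, hT, hμT⟩ := hμ
  obtain ⟨ν, hν⟩ := hh
  have hν : ∀ y, ν ((singular A).d n y) = μ.1 ((pushforward φ).f (n + 1) y) :=
    DFunLike.congr_fun hν
  -- Divisibility of `ℝ` extends the lift from cycles to all chains, so that it can be evaluated on
  -- `φ_* y` for arbitrary `y`.
  obtain ⟨S, hS⟩ := (Module.Baer.of_divisible ℝ).extension_property_addMonoidHom
    ((singular X).cycles n).subtype Subtype.val_injective T
  have hS : ∀ z : (singular X).cycles n, S z = T z := DFunLike.congr_fun hS
  have hμS : ∀ c, (μ.1 c : ℝ) = Form.integral α c - S ((singular X).d n c) := fun c =>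
    (hμT c).trans (congrArg _ (hS ((singular X).bd n c)).symm)
  obtain ⟨β, hβ⟩ := hA.exists_form_of_coboundary (α := Form.pullback φ α)
    (by rw [extD_pullback, hα.extD_eq_zero, map_zero])
    (S.comp ((pushforward φ).f n) + (Int.castAddHom ℝ).comp ν) (fun c => by
      change S ((pushforward φ).f n ((singular A).d n c)) + (ν ((singular A).d n c) : ℝ) = _
      rw [hν, hμS, (pushforward φ).comm, Form.integral_pullback]
      ring)
  obtain ⟨U, hU⟩ := (AbComplex.mem_coboundaries_iff _ _ _).1 hβ
  have hU : ∀ y, Form.integral β y - (S ((pushforward φ).f n y) + (ν y : ℝ)) =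
      U ((singular A).shiftD n y) := DFunLike.congr_fun hU
  -- With `F(s, t) = S s - U t`, the terms `S(φ_* y)` cancel on `∂_φ(x, y)`. What remains is `∫_x α
  -- + ∫_y β` minus the integer `μ x + ν y`, which `e` does not see.
  let F : (singular X).C n × (singular A).shiftC n →+ ℝ := S.coprod (-U)
  have hF : ∀ s t, F (s, t) = S s - U t := fun s t => (sub_eq_add_neg (S s) (U t)).symm
  let f : (relSingular φ).cycles n →+ Additive Circle :=
    (e.comp F).comp ((relSingular φ).cycles n).subtype
  have hf : HasRelCurvature f α β := fun x y => by
    change e (F ((singular X).d n x + (pushforward φ).f n y, -(singular A).shiftD n y)) = _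
    have h1 : F ((singular X).d n x + (pushforward φ).f n y, -(singular A).shiftD n y) =
        Form.integral α x + Form.integral β y - ((μ.1 x + ν y : ℤ) : ℝ) := by
      rw [hF, map_neg, ← hU, map_add]
      push_cast
      rw [hμS]
      ring
    rw [h1, map_sub, (e_eq_zero_iff ((μ.1 x + ν y : ℤ) : ℝ)).2 ⟨_, rfl⟩, sub_zero]
  refine ⟨⟨f, α, β, hf⟩, Subtype.ext (AddMonoidHom.ext fun z => ?_)⟩
  change e (F (z, 0)) = h.1 z
  rw [hF, map_zero, sub_zero, hS, hT]

/-! ### Degree zero and assembly of the sequence -/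

/-- There are no nonzero coboundaries in degree `0`, so classes are cocycles. A cone cocycle is a
cocycle `μ` on `X` with `μ ∘ φ_* = 0`, which is the condition that the pulled-back class vanish. -/
theorem exact_p_zero (φ : SmoothMap A X) :
    Function.Exact (RelDiffH.p φ 0) (pullbackC φ 0) := by
  intro q
  rw [pullbackC_eq_zero_iff]
  constructor
  · intro h
    obtain ⟨μ, rfl⟩ := QuotientAddGroup.mk_surjective q
    have h1 : μ.1.comp ((pushforward φ).f 0) = 0 := (pullbackH_mk_eq_zero_iff φ 0 μ).1 h
    have h2 : ∀ y, μ.1 ((pushforward φ).f 0 y) = 0 := DFunLike.congr_fun h1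
    have h3 : ∀ x, μ.1 ((singular X).d 0 x) = 0 := DFunLike.congr_fun μ.2
    refine ⟨QuotientAddGroup.mk ⟨μ.1.comp (AddMonoidHom.fst _ _), AddMonoidHom.ext ?_⟩, ?_⟩
    · rintro ⟨x, y⟩
      refine (map_add μ.1 _ _).trans ?_
      exact (congrArg₂ (· + ·) (h3 x) (h2 y)).trans (add_zero 0)
    · rfl
  · rintro ⟨r, rfl⟩
    obtain ⟨μ, rfl⟩ := QuotientAddGroup.mk_surjective r
    refine (pullbackH_mk_eq_zero_iff φ 0
      ((AbComplex.coneIncl (pushforward φ)).cocyclesMap ℤ 0 μ)).2 (AddMonoidHom.ext fun y => ?_)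
    have h1 : μ.1 ((singular X).d 0 0 + (pushforward φ).f 0 y, _) = 0 :=
      DFunLike.congr_fun μ.2 (0, y)
    rw [map_zero, zero_add] at h1
    exact h1

theorem p_zero_injective (φ : SmoothMap A X) : Function.Injective (RelDiffH.p φ 0) := by
  rw [injective_iff_map_eq_zero]
  intro r hr
  obtain ⟨μ, rfl⟩ := QuotientAddGroup.mk_surjective r
  have h1 : μ.1.comp (AddMonoidHom.inl _ _) = 0 := (QuotientAddGroup.eq_zero_iff
    ((AbComplex.coneIncl (pushforward φ)).cocyclesMap ℤ 0 μ)).1 hr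
  refine (QuotientAddGroup.eq_zero_iff μ).2 (AddMonoidHom.ext ?_)
  rintro ⟨s, t⟩
  exact DFunLike.congr_fun h1 s

theorem exact_p (hA : DeRhamTheorem A) (φ : SmoothMap A X) :
    ∀ k, Function.Exact (RelDiffH.p φ k) (pullbackC φ k)
  | 0 => exact_p_zero φ
  | n + 1 => fun h => by
    rw [pullbackC_eq_zero_iff]
    constructor
    · exact exists_charP_eq hA φ n h
    · rintro ⟨f, rfl⟩
      exact pullbackH_charClass_charP φ n f

theorem exact_pullbackFlat_i (φ : SmoothMap A X) (n : ℕ) :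
    Function.Exact (pullbackFlat φ n).subtype (DiffH.i φ n) := fun g =>
  (charI_eq_zero_iff φ n g).trans
    ⟨fun hg => ⟨⟨g, hg⟩, rfl⟩, by rintro ⟨g, rfl⟩; exact g.2⟩

end DiffCoh

theorem mainTheorem9 {A : Type*} {X : Type*} [DiffCoh.DifferentialSpace A]
    [DiffCoh.DifferentialSpace X] (hA : DiffCoh.DeRhamTheorem A) (hX : DiffCoh.DeRhamTheorem X)
    (φ : DiffCoh.SmoothMap A X) :
    (∀ n : ℕ,
      Function.Injective (DiffCoh.pullbackFlat φ n).subtype ∧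
      Function.Exact (DiffCoh.pullbackFlat φ n).subtype (DiffCoh.DiffH.i φ n) ∧
      Function.Exact (DiffCoh.DiffH.i φ n) (DiffCoh.RelDiffH.p φ (n + 2)) ∧
      Function.Exact (DiffCoh.RelDiffH.p φ (n + 2)) (DiffCoh.pullbackC φ (n + 2)) ∧
      Function.Surjective (DiffCoh.pullbackC φ (n + 2))) ∧
    (∀ k : ℕ, k = 0 ∨ k = 1 →
      Function.Injective (DiffCoh.RelDiffH.p φ k) ∧
      Function.Exact (DiffCoh.RelDiffH.p φ k) (DiffCoh.pullbackC φ k) ∧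
      Function.Surjective (DiffCoh.pullbackC φ k)) := by
  refine ⟨fun n => ⟨Subtype.val_injective, DiffCoh.exact_pullbackFlat_i φ n,
    DiffCoh.exact_charI_charP φ n, DiffCoh.exact_p hA φ (n + 2),
    DiffCoh.pullbackC_surjective hX φ (n + 2)⟩, fun k hk => ⟨?_, DiffCoh.exact_p hA φ k,
    DiffCoh.pullbackC_surjective hX φ k⟩⟩
  rcases hk with rfl | rfl
  · exact DiffCoh.p_zero_injective φ
  · exact DiffCoh.charP_zero_injective φ
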